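/- A \emph{diversity} is a set $X$ with a function $\delta$ from the finite subsets of $X$ to $\mathbb{R}$ such that (D1) $\delta(A)\ge 0$, with $\delta(A)=0$ if and only if $|A|\le 1$, and (D2) $\delta(A\cup C)\le \delta(A\cup B)+\delta(B\cup C)$ whenever $B\ne\emptyset$. A \emph{semidiversity} is defined in the same way, except that $\delta(A)=0$ is also allowed when $|A|>1$. The induced metric is $d(x,y)=\delta(\{x,y\})$. A diversity (complete in its induced metric) is viewed as a relational metric structure with the predicates $\delta_k(x_1,\dots,x_k)=\delta(\{x_1,\dots,x_k\})$, $k\ge 1$. Embeddings are maps preserving the metric and all predicates; isomorphisms are surjective embeddings. For a class $\mathcal K$ of finite relational metric structures, let $\mathcal K_n$ be the set of $n$-tuples (with repetitions allowed) of elements of members of $\mathcal K$. An embedding of such a tuple is a map on its entries preserving the metric and all predicates. For $\bar a,\bar b\in\mathcal K_n$ let $d_{\mathcal K}(\bar a,\bar b)$ be the infimum of $\max_i d(a_i',b_i')$ over all images $\bar a',\bar b'$ of $\bar a,\bar b$ under embeddings into a common member of $\mathcal K$, and let $d_\infty(\bar a,\bar b)$ be the maximum of $|R(\bar a_I)-R(\bar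 b_I)|$ over all $I\subseteq\{1,\dots,n\}$ and all predicates $R$ of arity $|I|$, the metric included (with $d_\infty=0$ if there is no such pair). The class $\mathcal K$ has \begin{itemize} \item HP, if every finite structure that embeds in a member of $\mathcal K$ is in $\mathcal K$; \item JEP, if any two members of $\mathcal K$ embed in a third; \item AP, if for all embeddings $f_B\colon A\to B$, $f_C\colon A\to C$ between members of $\mathcal K$ there are $D\in\mathcal K$ and embeddings $g_B\colon B\to D$, $g_C\colon C\to D$ with $g_Bf_B=g_Cf_C$; \item bAP, if for each $n$ there is a constant $c$ such that any $(\bar a,w),(\bar a,z)\in\mathcal K_{n+1}$ with the same structure on $\bar a$ have an amalgamation $(\bar a,w,z)$ in a member of $\mathcal K$ with $d(w,z)\le c\,d_\infty((\bar a,w),(\bar a,z))$; \item PP, if for each $n$, $d_{\mathcal K}$ is a pseudometric on $\mathcal K_n$ for which $\mathcal K_n$ is separable and complete; \item CP, if for each $n$-ary predicate $P$ (the metric included) the map $\bar a\mapsto P(\bar a)$ is continuous on $(\mathcal K_n,d_{\mathcal K})$. \end{itemize} $\mathcal K$ is a \emph{Fra\"iss\'e class} if it has HP, JEP, AP, PP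 and CP. A \emph{$\mathcal K$-structure} is a metric structure all of whose finite substructures are in $\mathcal K$. A separable $\mathcal K$-structure $M$ is an \emph{exact limit} of $\mathcal K$ if for all $B\in\mathcal K$ and finite tuples $\bar a$ in $B$, every embedding of $\bar a$ in $M$ extends to an embedding of $B$ in $M$; it is an \emph{approximate limit} if for every $\varepsilon>0$ there is an embedding of $B$ in $M$ that moves the entries of $\bar a$ to within $\varepsilon$ of their given images. A separable structure $M$ is \emph{ultrahomogeneous} if every embedding of a finite subset of $M$ into $M$ extends to an automorphism of $M$. \textbf{Theorem.} Let $\mathcal K$ be the class of finite diversities, viewed as relational metric structures. \begin{enumerate} \item $\mathcal K$ satisfies HP, JEP, bAP, PP and CP, and it is a Fra\"iss\'e class. \item There is a metric structure $M$ (the Urysohn diversity) which is an approximate and exact limit of $\mathcal K$, is a diversity, is ultrahomogeneous, and is universal: every separable $\mathcal K$-structure embeds in $M$. Every approximate limit of $\mathcal K$ is isomorphic to $M$, and so is every ultrahomogeneous $\mathcal K$-structure in which every separable $\mathcal K$-structure embeds. \item bAP holds with $c=1$ for every $n$. \item Let $X$ be a finite set and let $\delta$ be given by diversities on $X\cup\{z_1\}$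 and on $X\cup\{z_2\}$ that agree on $X$. Extending $\delta$ by $$\delta(A\cup\{z_1,z_2\})=\max\Big[\sup_{B\subseteq X}\big(\delta(A\cup B\cup\{z_1\})-\delta(B\cup\{z_2\})\big),\ \sup_{C\subseteq X}\big(\delta(A\cup C\cup\{z_2\})-\delta(C\cup\{z_1\})\big)\Big]\qquad(A\subseteq X)$$ gives a semidiversity on $X\cup\{z_1,z_2\}$ which is pointwise the smallest semidiversity extending both given diversities. It is a diversity if $\delta(\{z_1,z_2\})\neq 0$, and $\delta(\{z_1,z_2\})=\sup_{A\subseteq X}|\delta(A\cup\{z_1\})-\delta(A\cup\{z_2\})|$. \item For all $n\ge 1$ and $\bar a,\bar b\in\mathcal K_n$: $\frac1n d_\infty(\bar a,\bar b)\le d_{\mathcal K}(\bar a,\bar b)\le d_\infty(\bar a,\bar b)$. \end{enumerate} -/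

import Mathlib

universe u

/-! ## Relational metric structures -/

/-- A relational language: predicate symbols with arities. The metric is a further,
distinguished binary predicate symbol and is not listed here. -/
structure RelLang where
  Pred : Type
  arity : Pred → ℕ

/-- A metric structure: a complete metric space together with a uniformly continuous
interpretation of every predicate symbol. -/
structure MetricStr (L : RelLang) where
  carrier : Type u
  [metric : MetricSpace carrier]
  [complete : CompleteSpace carrier]
  interp : (R : L.Pred) → (Fin (L.arity R) → carrier) → ℝ
  unifCont : ∀ R, UniformContinuous (interp R)

attribute [instance] MetricStr.metric MetricStr.complete

instance (L : RelLang) : CoeSort (MetricStr.{u} L) (Type u) := ⟨MetricStr.carrier⟩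

section

variable {L : RelLang}

/-- Embeddings preserve every predicate, including the metric. -/
structure MetricStr.Emb (A B : MetricStr.{u} L) where
  toFun : A → B
  map_dist : ∀ x y : A, dist (toFun x) (toFun y) = dist x y
  map_pred : ∀ (R : L.Pred) (x : Fin (L.arity R) → A),
    B.interp R (fun i => toFun (x i)) = A.interp R x

/-- Isomorphisms are surjective embeddings. -/
structure MetricStr.Iso (A B : MetricStr.{u} L) extends MetricStr.Emb A B where
  surj : Function.Surjective toFun

/-- Extension of finite partial isomorphisms (embeddings `S → M` with `S ⊆ M` finite) to
automorphisms, for separable `M`. -/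
def MetricStr.Ultrahomogeneous (M : MetricStr.{u} L) : Prop :=
  TopologicalSpace.SeparableSpace M ∧
  ∀ (S : Set M) (φ : S → M), S.Finite →
    (∀ x y : S, dist (φ x) (φ y) = dist (x : M) (y : M)) →
    (∀ (R : L.Pred) (x : Fin (L.arity R) → S),
      M.interp R (fun i => φ (x i)) = M.interp R (fun i => (x i : M))) →
    ∃ g : MetricStr.Iso M M, ∀ x : S, g.toFun x = φ x

/-- The tuple `b` of `B` is the image of the tuple `a` of `A` under an embedding of the
enumerated structure `a` into `B`: all predicates, the metric included, take the same values
on corresponding tuples of entries. -/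
def MetricStr.IsCopy {A B : MetricStr.{u} L} {n : ℕ} (a : Fin n → A) (b : Fin n → B) : Prop :=
  (∀ i j, dist (b i) (b j) = dist (a i) (a j)) ∧
  ∀ (R : L.Pred) (s : Fin (L.arity R) → Fin n),
    B.interp R (fun k => b (s k)) = A.interp R (fun k => a (s k))

/-! ## Classes of finite metric structures -/

/-- `K`-structures: all finite substructures belong to `K`. -/
def IsKStructure (K : Set (MetricStr.{u} L)) (A : MetricStr.{u} L) : Prop :=
  ∀ B : MetricStr.{u} L, Finite B → Nonempty (MetricStr.Emb B A) → B ∈ K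

/-- Hereditary property. -/
def HP (K : Set (MetricStr.{u} L)) : Prop := ∀ A ∈ K, IsKStructure K A

/-- Joint embedding property. -/
def JEP (K : Set (MetricStr.{u} L)) : Prop :=
  ∀ A ∈ K, ∀ B ∈ K, ∃ C ∈ K, Nonempty (MetricStr.Emb A C) ∧ Nonempty (MetricStr.Emb B C)

/-- Amalgamation property. -/
def AP (K : Set (MetricStr.{u} L)) : Prop :=
  ∀ A ∈ K, ∀ B ∈ K, ∀ C ∈ K, ∀ (fB : MetricStr.Emb A B) (fC : MetricStr.Emb A C),
    ∃ D ∈ K, ∃ (gB : MetricStr.Emb B D) (gC : MetricStr.Emb C D),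
      ∀ x : A, gB.toFun (fB.toFun x) = gC.toFun (fC.toFun x)

/-- Enumerated structures of length `n`: `n`-tuples of elements of a member of `K`
(repetitions allowed). -/
structure EnumStr (K : Set (MetricStr.{u} L)) (n : ℕ) where
  str : MetricStr.{u} L
  mem : str ∈ K
  tup : Fin n → str

/-- The distance `d_K` of enumerated structures: the infimum of `max_i d(a'_i, b'_i)` over all
joint embeddings `a'`, `b'` of `a`, `b` into a member of `K`.
(`dist a' b'` is the maximum distance of corresponding entries.) -/
noncomputable def dK {K : Set (MetricStr.{u} L)} {n : ℕ} (a b : EnumStr K n) : ℝ :=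
  sInf {r : ℝ | ∃ D ∈ K, ∃ a' b' : Fin n → D,
    MetricStr.IsCopy a.tup a' ∧ MetricStr.IsCopy b.tup b' ∧ r = dist a' b'}

/-- The set of all `|R(a_X) - R(b_X)|`, where `X` is a set of indices, `R` a predicate of arity
`|X|` (or the metric, in which case `X = {i, j}`) and `a_X` is the sub-tuple of `a` with indices
in `X`, in increasing order. -/
def predDiffs {K : Set (MetricStr.{u} L)} {n : ℕ} (a b : EnumStr K n) : Set ℝ :=
  {r : ℝ | ∃ i j : Fin n, r = |dist (a.tup i) (a.tup j) - dist (b.tup i) (b.tup j)|} ∪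
  {r : ℝ | ∃ (X : Finset (Fin n)) (R : L.Pred) (h : X.card = L.arity R),
    r = |a.str.interp R (fun k => a.tup (X.orderEmbOfFin h k)) -
          b.str.interp R (fun k => b.tup (X.orderEmbOfFin h k))|}

/-- The distance `d_∞` of enumerated structures (a maximum if there are finitely many
predicates of each arity). -/
noncomputable def dInfty {K : Set (MetricStr.{u} L)} {n : ℕ} (a b : EnumStr K n) : ℝ :=
  sSup (predDiffs a b)

/-- One-point amalgamation with bound `c`, for tuples `(ā, w)`, `(ā, z)` of length `n + 1`
which agree on their first `n` entries. -/
def BAPWith (K : Set (MetricStr.{u} L)) (n : ℕ) (c : ℝ) : Prop :=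
  ∀ p q : EnumStr K (n + 1),
    MetricStr.IsCopy (fun i : Fin n => p.tup i.castSucc) (fun i : Fin n => q.tup i.castSucc) →
    ∃ B ∈ K, ∃ p' q' : Fin (n + 1) → B,
      MetricStr.IsCopy p.tup p' ∧ MetricStr.IsCopy q.tup q' ∧
      (∀ i : Fin n, p' i.castSucc = q' i.castSucc) ∧
      dist (p' (Fin.last n)) (q' (Fin.last n)) ≤ c * dInfty p q

/-- Bounded amalgamation property: the constant depends only on the length. -/
def BAP (K : Set (MetricStr.{u} L)) : Prop := ∀ n : ℕ, ∃ c : ℝ, BAPWith K n c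

/-- Polish property: for every `n`, `d_K` is a pseudometric on the enumerated structures of
length `n` for which they form a separable complete space. -/
def PP (K : Set (MetricStr.{u} L)) : Prop :=
  ∀ n : ℕ, ∃ P : PseudoMetricSpace (EnumStr K n),
    (∀ a b : EnumStr K n, P.dist a b = dK a b) ∧
    TopologicalSpace.SeparableSpace (EnumStr K n) ∧ CompleteSpace (EnumStr K n)

/-- Continuity property: every predicate, the metric included, is continuous for `d_K`. -/
def CP (K : Set (MetricStr.{u} L)) : Prop :=
  (∀ (R : L.Pred) (a : EnumStr K (L.arity R)), ∀ ε > 0, ∃ η > 0, ∀ b : EnumStr K (L.arity R),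
    dK a b < η → |b.str.interp R b.tup - a.str.interp R a.tup| < ε) ∧
  (∀ a : EnumStr K 2, ∀ ε > 0, ∃ η > 0, ∀ b : EnumStr K 2,
    dK a b < η → |dist (b.tup 0) (b.tup 1) - dist (a.tup 0) (a.tup 1)| < ε)

/-- Fraïssé classes of finite metric structures. -/
structure IsFraisseClass (K : Set (MetricStr.{u} L)) : Prop where
  finite : ∀ A ∈ K, Finite A
  hp : HP K
  jep : JEP K
  ap : AP K
  pp : PP K
  cp : CP K

/-- Approximate limits: separable `K`-structures with the approximate extension property. -/
structure IsApproxLimit (K : Set (MetricStr.{u} L)) (M : MetricStr.{u} L) : Prop where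
  separable : TopologicalSpace.SeparableSpace M
  isKStructure : IsKStructure K M
  ext : ∀ B ∈ K, ∀ (n : ℕ) (a : Fin n → B) (h : Fin n → M), MetricStr.IsCopy a h →
    ∀ ε > 0, ∃ f : MetricStr.Emb B M, ∀ i, dist (f.toFun (a i)) (h i) < ε

/-- Exact limits: separable `K`-structures with the exact extension property. -/
structure IsExactLimit (K : Set (MetricStr.{u} L)) (M : MetricStr.{u} L) : Prop where
  separable : TopologicalSpace.SeparableSpace M
  isKStructure : IsKStructure K M
  ext : ∀ B ∈ K, ∀ (n : ℕ) (a : Fin n → B) (h : Fin n → M), MetricStr.IsCopy a h →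
    ∃ f : MetricStr.Emb B M, ∀ i, f.toFun (a i) = h i

/-- Every separable `K`-structure embeds into `M`. -/
def IsUniversalFor (K : Set (MetricStr.{u} L)) (M : MetricStr.{u} L) : Prop :=
  ∀ N : MetricStr.{u} L, TopologicalSpace.SeparableSpace N → IsKStructure K N →
    Nonempty (MetricStr.Emb N M)

end

/-! ## Diversities -/

open Classical in
/-- Semidiversities: diversities which may vanish on sets with more than one point. -/
structure IsSemidiversity {X : Type u} (δ : Finset X → ℝ) : Prop where
  nonneg : ∀ A, 0 ≤ δ A
  eq_zero : ∀ A, A.card ≤ 1 → δ A = 0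
  triangle : ∀ A B C, B.Nonempty → δ (A ∪ C) ≤ δ (A ∪ B) + δ (B ∪ C)

/-- Diversities. -/
structure IsDiversity {X : Type u} (δ : Finset X → ℝ) : Prop extends IsSemidiversity δ where
  card_le_one : ∀ A, δ A = 0 → A.card ≤ 1

/-- The language of diversities: one predicate `δ_k` of arity `k` for every `k ≥ 1`. -/
def divLang : RelLang where
  Pred := {k : ℕ // 1 ≤ k}
  arity k := k

/-- There are only finitely many predicate differences in the language of diversities, so `d_∞`
is a maximum for it. -/
theorem predDiffs_finite {K : Set (MetricStr.{u} divLang)} {n : ℕ} (a b : EnumStr K n) :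
    (predDiffs a b).Finite := by
  refine Set.Finite.union ?_ ?_
  · refine (Set.finite_range fun ij : Fin n × Fin n =>
      |dist (a.tup ij.1) (a.tup ij.2) - dist (b.tup ij.1) (b.tup ij.2)|).subset ?_
    rintro r ⟨i, j, rfl⟩
    exact ⟨(i, j), rfl⟩
  · refine (Set.finite_range fun X : {X : Finset (Fin n) // 1 ≤ X.card} =>
      |a.str.interp (⟨X.1.card, X.2⟩ : divLang.Pred)
          (fun k => a.tup (X.1.orderEmbOfFin rfl k)) -
        b.str.interp (⟨X.1.card, X.2⟩ : divLang.Pred)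
          (fun k => b.tup (X.1.orderEmbOfFin rfl k))|).subset ?_
    rintro r ⟨X, ⟨m, hm⟩, h, rfl⟩
    change X.card = m at h
    subst h
    exact ⟨⟨X, hm⟩, rfl⟩

open Classical in
/-- The metric structure `A` is the diversity `δ` on its carrier: its metric is the induced
metric and `δ_k(x_1, …, x_k) = δ({x_1, …, x_k})`. -/
def IsDiversityStr (A : MetricStr.{u} divLang) : Prop :=
  ∃ δ : Finset A → ℝ, IsDiversity δ ∧ (∀ x y : A, dist x y = δ {x, y}) ∧
    ∀ (R : divLang.Pred) (x : Fin (divLang.arity R) → A),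
      A.interp R x = δ (Finset.univ.image x)

/-- The class of finite diversities, viewed as relational metric structures. -/
def finDiversities : Set (MetricStr.{u} divLang) := {A | Finite A ∧ IsDiversityStr A}

open Classical in
/-- The induced metric of a diversity. -/
noncomputable abbrev IsDiversity.metricSpace {X : Type u} {δ : Finset X → ℝ}
    (h : IsDiversity δ) : MetricSpace X where
  dist x y := δ {x, y}
  dist_self x := h.eq_zero _ (by simp)
  dist_comm x y := by rw [Finset.pair_comm]
  dist_triangle x y z := by
    have := h.triangle {x} {y} {z} (by simp)
    rwa [← Finset.insert_eq, ← Finset.insert_eq, ← Finset.insert_eq] at this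
  eq_of_dist_eq_zero {x y} hxy := by
    have := h.card_le_one _ hxy
    exact Finset.card_le_one.1 this x (by simp) y (by simp)

open Classical in
/-- Every finite diversity, viewed as a metric structure. -/
noncomputable def IsDiversity.toMetricStr {X : Type u} [Finite X] {δ : Finset X → ℝ}
    (h : IsDiversity δ) : MetricStr.{u} divLang :=
  letI := h.metricSpace
  { carrier := X
    interp := fun _ x => δ (Finset.univ.image x)
    unifCont := fun _ =>
      CompactSpace.uniformContinuous_of_continuous continuous_of_discreteTopology }

theorem IsDiversity.toMetricStr_mem {X : Type u} [hX : Finite X] {δ : Finset X → ℝ}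
    (h : IsDiversity δ) : h.toMetricStr ∈ finDiversities.{u} :=
  ⟨hX, δ, h, fun _ _ => rfl, fun _ _ => rfl⟩

/-! ## The minimal one-point amalgamation

`X ∪ {z}` is `Option X` with `z = none`, so that `B ∪ {z}` is `Finset.insertNone B`;
`X ∪ {z₁, z₂}` is `X ⊕ Bool` with `z₁ = Sum.inr false` and `z₂ = Sum.inr true`. -/

/-- The inclusion of `X ∪ {z}` in `X ∪ {z₁, z₂}` that maps `z` to `z₁` (`b = false`) or to `z₂`
(`b = true`). -/
def inclPt {X : Type u} (b : Bool) : Option X → X ⊕ Bool := fun o => o.elim (Sum.inr b) Sum.inl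

open Classical in
/-- `γ` is a semidiversity on `X ∪ {z₁, z₂}` that extends `δ₁` on `X ∪ {z₁}` and `δ₂` on
`X ∪ {z₂}`. -/
structure IsOnePointAmalgam {X : Type u} (δ₁ δ₂ : Finset (Option X) → ℝ)
    (γ : Finset (X ⊕ Bool) → ℝ) : Prop where
  semi : IsSemidiversity γ
  left : ∀ A : Finset (Option X), γ (A.image (inclPt false)) = δ₁ A
  right : ∀ A : Finset (Option X), γ (A.image (inclPt true)) = δ₂ A

open Classical in
/-- The minimal amalgamation of `δ₁` and `δ₂`, for finite `X`:
`δ(A ∪ {z₁, z₂})` is the maximum of `sup_B δ(A ∪ B ∪ {z₁}) - δ(B ∪ {z₂})` and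
`sup_C δ(A ∪ C ∪ {z₂}) - δ(C ∪ {z₁})`. -/
noncomputable def minAmalgam {X : Type u} (δ₁ δ₂ : Finset (Option X) → ℝ)
    (S : Finset (X ⊕ Bool)) : ℝ :=
  if Sum.inr false ∈ S then
    if Sum.inr true ∈ S then
      max (⨆ B : Finset X,
            (δ₁ (Finset.insertNone (S.toLeft ∪ B)) - δ₂ (Finset.insertNone B)))
          (⨆ C : Finset X,
            (δ₂ (Finset.insertNone (S.toLeft ∪ C)) - δ₁ (Finset.insertNone C)))
    else δ₁ (Finset.insertNone S.toLeft)
  else if Sum.inr true ∈ S then δ₂ (Finset.insertNone S.toLeft)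
  else δ₁ (S.toLeft.map Function.Embedding.some)

/-! Everything rests on one-point extensions. An extension of a finite set F by a point z is coded
by the function f(A) = δ(A ∪ {z}) on subsets of F (`KatOn`), the analogue of a Katětov function. A
semidiversity is a monotone set function that is subadditive on sets that meet
(`IsSemidiversity.of_glue`), so moving points changes its values by at most the sum of the
displacements (`IsSemidiversity.abs_image_sub_le`). This Lipschitz estimate lets δ pass to
completions and partial isomorphisms to closures, and it gives d_∞ ≤ n · d_K.

If f₁, f₂ describe two extensions of F, every amalgam m(A) = δ(A ∪ {z₁, z₂}) satisfies f₁(A ∪ B) ≤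
m(A) + f₂(B) and the mirror inequality. The least solution (`IsMinGap`) already gives a
semidiversity, with m(∅) = sup |f₁ - f₂|. This yields the explicit amalgamation, bAP with constant
1, and `KatOn.exists_insert`, which extends f over a further point y while keeping the new point
close to y.

For the limit, a semidiversity on ℕ is built that approximately realises all one-point extensions of
its finite subsets (`exists_semidiversity_approxExt`). Its completion inherits this
(`exists_diversity_completion`), and in a complete space approximate realisations can be corrected
into a convergent sequence (`ApproxExt.exactExt`). Exact one-point extensions then give embeddings,
uniqueness and homogeneity by back-and-forth. JEP, AP and PP are read off inside the exact limit,
where tuples have actual copies and d_K is controlled by distances between these.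

The bound d_K ≤ d_∞ needs all n points moved at once. It comes from an explicit semidiversity on two
copies of the index set (`IsSemidiversity.exists_coupling`). Such constructions may identify points;
`IsSemidiversity.exists_realization` passes to the quotient, which is harmless because tuples may
have repetitions. -/

/-! ## Semidiversities -/

section Semidiversity

variable {X Y : Type*}

theorem IsSemidiversity.triangle' {X : Type u} [DecidableEq X] {δ : Finset X → ℝ}
    (h : IsSemidiversity δ) (A B C : Finset X) (hB : B.Nonempty) :
    δ (A ∪ C) ≤ δ (A ∪ B) + δ (B ∪ C) := by
  convert h.triangle A B C hB

theorem IsSemidiversity.empty {X : Type u} {δ : Finset X → ℝ} (h : IsSemidiversity δ) :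
    δ ∅ = 0 := h.eq_zero _ (by simp)

theorem IsSemidiversity.singleton {X : Type u} {δ : Finset X → ℝ} (h : IsSemidiversity δ)
    (x : X) : δ {x} = 0 := h.eq_zero _ (by simp)

/-- The triangle inequality with middle set `{x}` and empty third set shows that adding one point
does not decrease the value. -/
theorem IsSemidiversity.mono {X : Type u} {δ : Finset X → ℝ} (h : IsSemidiversity δ)
    {A B : Finset X} (hAB : A ⊆ B) : δ A ≤ δ B := by
  classical
  have key : ∀ (x : X) (A : Finset X), δ A ≤ δ (insert x A) := by
    intro x A
    have h1 := h.triangle' A {x} ∅ (by simp)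
    rwa [Finset.union_empty, Finset.union_empty, h.singleton, add_zero, Finset.union_comm,
      ← Finset.insert_eq] at h1
  have : ∀ C : Finset X, δ A ≤ δ (C ∪ A) := by
    intro C
    induction C using Finset.induction_on with
    | empty => simp
    | insert x C _ ih => exact ih.trans (by rw [Finset.insert_union]; exact key _ _)
  simpa [Finset.union_eq_left.2 hAB] using this B

theorem IsSemidiversity.glue {X : Type u} [DecidableEq X] {δ : Finset X → ℝ}
    (h : IsSemidiversity δ) {A B : Finset X} (hAB : (A ∩ B).Nonempty) :
    δ (A ∪ B) ≤ δ A + δ B := by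
  have := h.triangle' A (A ∩ B) B hAB
  rwa [Finset.union_eq_left.2 Finset.inter_subset_left,
    Finset.union_eq_right.2 Finset.inter_subset_right] at this

/-- The sets A ∪ B and B ∪ C meet in B, so the triangle inequality is an instance of `glue` followed
by monotonicity. With two sets instead of three, the later verifications become case splits on which
new points each set contains. -/
theorem IsSemidiversity.of_glue {X : Type u} [DecidableEq X] {δ : Finset X → ℝ}
    (empty : δ ∅ = 0) (singleton : ∀ x, δ {x} = 0) (mono : ∀ A B, A ⊆ B → δ A ≤ δ B)
    (glue : ∀ A B, (A ∩ B).Nonempty → δ (A ∪ B) ≤ δ A + δ B) : IsSemidiversity δ where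
  nonneg A := empty ▸ mono _ _ (Finset.empty_subset A)
  eq_zero A hA := by
    by_cases hX : A = ∅
    · rw [hX, empty]
    · obtain ⟨x, hx⟩ := Finset.nonempty_iff_ne_empty.2 hX
      have : A = {x} := Finset.eq_singleton_iff_unique_mem.2
        ⟨hx, fun y hy => Finset.card_le_one.1 hA y hy x hx⟩
      rw [this, singleton]
  triangle A B C hB := by
    have h1 := glue (A ∪ B) (B ∪ C) (hB.mono (by intro x hx; simp [hx]))
    refine le_trans (mono _ _ ?_) (h1.trans (le_of_eq ?_))
    · intro x hx
      simp only [Finset.mem_union] at hx ⊢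
      tauto
    · congr!

theorem IsSemidiversity.comap {X Y : Type*} [DecidableEq X] {δ : Finset X → ℝ}
    (h : IsSemidiversity δ) (f : Y → X) : IsSemidiversity fun S : Finset Y => δ (S.image f) := by
  classical
  refine .of_glue (by simp [h.empty]) (by simp [h.singleton])
    (fun A B hAB => h.mono (Finset.image_subset_image hAB)) fun A B hAB => ?_
  simp only [Finset.image_union]
  obtain ⟨x, hx⟩ := hAB
  rw [Finset.mem_inter] at hx
  exact h.glue ⟨f x, Finset.mem_inter.2
    ⟨Finset.mem_image_of_mem _ hx.1, Finset.mem_image_of_mem _ hx.2⟩⟩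

/-- The function `g` on subsets of `F` is monotone, and grows by at most `δ B` when a set `B` that
meets its argument is added. -/
structure GlueOn {X : Type*} [DecidableEq X] (δ : Finset X → ℝ) (F : Finset X)
    (g : Finset X → ℝ) : Prop where
  mono : ∀ A B, A ⊆ B → B ⊆ F → g A ≤ g B
  glue : ∀ A B, A ⊆ F → B ⊆ F → (A ∩ B).Nonempty → g (A ∪ B) ≤ g A + δ B

theorem IsSemidiversity.glueOn {X : Type u} [DecidableEq X] {δ : Finset X → ℝ}
    (h : IsSemidiversity δ) (F : Finset X) : GlueOn δ F δ :=
  ⟨fun _ _ h1 _ => h.mono h1, fun _ _ _ _ h1 => h.glue h1⟩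

/-- The points `y i` are adjoined one at a time: the pair `{x i, y i}` meets the current set in `x
i`, so it costs at most its diversity. At the end the points `x i` are dropped by monotonicity. -/
theorem GlueOn.image_le {X ι : Type*} [DecidableEq X] {δ g : Finset X → ℝ} {F : Finset X}
    (hg : GlueOn δ F g) (S : Finset ι) (x y : ι → X) (hx : S.image x ⊆ F) (hy : S.image y ⊆ F) :
    g (S.image y) ≤ g (S.image x) + ∑ i ∈ S, δ {x i, y i} := by
  classical
  have key : ∀ T, T ⊆ S → g (S.image x ∪ T.image y) ≤ g (S.image x) + ∑ i ∈ T, δ {x i, y i} := by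
    intro T
    induction T using Finset.induction_on with
    | empty => simp
    | insert i T hi ih =>
      intro hT
      have hiS : i ∈ S := hT (Finset.mem_insert_self _ _)
      have hTS : T ⊆ S := (Finset.subset_insert _ _).trans hT
      have hxi : x i ∈ S.image x := Finset.mem_image_of_mem _ hiS
      have h1 := hg.glue (S.image x ∪ T.image y) {x i, y i}
        (Finset.union_subset hx ((Finset.image_subset_image hTS).trans hy))
        (by
          intro z hz
          rw [Finset.mem_insert, Finset.mem_singleton] at hz
          rcases hz with rfl | rfl
          · exact hx hxi
          · exact hy (Finset.mem_image_of_mem _ hiS))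
        ⟨x i, by simp only [Finset.mem_inter, Finset.mem_union, Finset.mem_insert]; tauto⟩
      have h2 : S.image x ∪ T.image y ∪ {x i, y i} = S.image x ∪ (insert i T).image y := by
        ext z
        simp only [Finset.mem_union, Finset.mem_insert, Finset.mem_singleton, Finset.image_insert]
        constructor
        · rintro ((h | h) | rfl | rfl) <;> tauto
        · tauto
      rw [h2] at h1
      rw [Finset.sum_insert hi]
      linarith [ih hTS]
  refine le_trans (hg.mono _ _ Finset.subset_union_right (Finset.union_subset hx hy))
    (key S subset_rfl)

theorem GlueOn.abs_image_sub_le {X ι : Type*} [DecidableEq X] {δ g : Finset X → ℝ}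
    {F : Finset X} (hg : GlueOn δ F g) (S : Finset ι) (x y : ι → X) (hx : S.image x ⊆ F)
    (hy : S.image y ⊆ F) :
    |g (S.image x) - g (S.image y)| ≤ ∑ i ∈ S, δ {x i, y i} := by
  have h1 := hg.image_le S x y hx hy
  have h2 := hg.image_le S y x hy hx
  have h3 : ∑ i ∈ S, δ {y i, x i} = ∑ i ∈ S, δ {x i, y i} :=
    Finset.sum_congr rfl fun i _ => by rw [Finset.pair_comm]
  rw [abs_le]
  constructor <;> linarith

theorem IsSemidiversity.abs_image_sub_le {X : Type u} {ι : Type*} [DecidableEq X]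
    {δ : Finset X → ℝ} (h : IsSemidiversity δ) (S : Finset ι) (x y : ι → X) :
    |δ (S.image x) - δ (S.image y)| ≤ ∑ i ∈ S, δ {x i, y i} :=
  (h.glueOn (S.image x ∪ S.image y)).abs_image_sub_le S x y Finset.subset_union_left
    Finset.subset_union_right

theorem IsSemidiversity.abs_insert_sub_le {X : Type u} [DecidableEq X]
    {δ : Finset X → ℝ} (h : IsSemidiversity δ) (A : Finset X) (y z : X) :
    |δ (insert y A) - δ (insert z A)| ≤ δ {y, z} := by
  have key : ∀ y z, δ (insert z A) ≤ δ (insert y A) + δ {y, z} := by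
    intro y z
    have h1 := h.glue (A := insert y A) (B := {y, z}) ⟨y, by simp⟩
    refine (h.mono ?_).trans h1
    intro w hw
    simp only [Finset.mem_insert, Finset.mem_union, Finset.mem_singleton] at hw ⊢
    tauto
  have h1 := key y z
  have h2 := key z y
  rw [Finset.pair_comm] at h2
  rw [abs_le]
  constructor <;> linarith

/-! ## One-point extensions -/

/-- The function `f` on subsets of `F` describes a one-point extension `F ∪ {z}` of the
restriction of `δ` to `F`, by `f A = δ (A ∪ {z})`. -/
structure KatOn {X : Type*} [DecidableEq X] (δ : Finset X → ℝ) (F : Finset X)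
    (f : Finset X → ℝ) : Prop extends GlueOn δ F f where
  zero : f ∅ = 0
  sub : ∀ A B, A ⊆ F → B ⊆ F → f (A ∪ B) ≤ f A + f B
  tri : ∀ A B, A ⊆ F → B ⊆ F → δ (A ∪ B) ≤ f A + f B

theorem KatOn.le {X : Type*} [DecidableEq X] {δ f : Finset X → ℝ} {F : Finset X}
    (h : KatOn δ F f) {A : Finset X} (hA : A ⊆ F) : δ A ≤ f A := by
  simpa [h.zero] using h.tri A ∅ hA (Finset.empty_subset _)

theorem KatOn.subset {X : Type*} [DecidableEq X] {δ f : Finset X → ℝ} {F G : Finset X}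
    (h : KatOn δ G f) (hFG : F ⊆ G) : KatOn δ F f where
  mono A B hAB hB := h.mono A B hAB (hB.trans hFG)
  glue A B hA hB hAB := h.glue A B (hA.trans hFG) (hB.trans hFG) hAB
  zero := h.zero
  sub A B hA hB := h.sub A B (hA.trans hFG) (hB.trans hFG)
  tri A B hA hB := h.tri A B (hA.trans hFG) (hB.trans hFG)

theorem KatOn.congr {X : Type*} [DecidableEq X] {δ δ' f f' : Finset X → ℝ} {F : Finset X}
    (h : KatOn δ F f) (hδ : ∀ A, A ⊆ F → δ A = δ' A) (hf : ∀ A, A ⊆ F → f A = f' A) :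
    KatOn δ' F f' where
  mono A B hAB hB := by
    rw [← hf B hB, ← hf A (hAB.trans hB)]; exact h.mono A B hAB hB
  glue A B hA hB hAB := by
    rw [← hf A hA, ← hf _ (Finset.union_subset hA hB), ← hδ B hB]; exact h.glue A B hA hB hAB
  zero := by rw [← hf _ (Finset.empty_subset _), h.zero]
  sub A B hA hB := by
    rw [← hf A hA, ← hf _ (Finset.union_subset hA hB), ← hf B hB]; exact h.sub A B hA hB
  tri A B hA hB := by
    rw [← hf A hA, ← hδ _ (Finset.union_subset hA hB), ← hf B hB]; exact h.tri A B hA hB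

theorem KatOn.comap {X Y : Type*} [DecidableEq X] [DecidableEq Y] {δ f : Finset X → ℝ}
    {F : Finset Y} {φ : Y → X} (h : KatOn δ (F.image φ) f) :
    KatOn (fun A => δ (A.image φ)) F fun A => f (A.image φ) where
  mono A B hAB hB := h.mono _ _ (Finset.image_subset_image hAB) (Finset.image_subset_image hB)
  glue A B hA hB hAB := by
    simp only [Finset.image_union]
    refine h.glue _ _ (Finset.image_subset_image hA) (Finset.image_subset_image hB) ?_
    obtain ⟨x, hx⟩ := hAB
    rw [Finset.mem_inter] at hx
    exact ⟨φ x, Finset.mem_inter.2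
      ⟨Finset.mem_image_of_mem _ hx.1, Finset.mem_image_of_mem _ hx.2⟩⟩
  zero := by simp [h.zero]
  sub A B hA hB := by
    simp only [Finset.image_union]
    exact h.sub _ _ (Finset.image_subset_image hA) (Finset.image_subset_image hB)
  tri A B hA hB := by
    simp only [Finset.image_union]
    exact h.tri _ _ (Finset.image_subset_image hA) (Finset.image_subset_image hB)

theorem IsSemidiversity.katOn_comap {X : Type u} {Y : Type*} [DecidableEq X] [DecidableEq Y]
    {δ : Finset X → ℝ} (h : IsSemidiversity δ) (φ : Y → X) (z : X) (F : Finset Y) :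
    KatOn (fun A => δ (A.image φ)) F fun A => δ (insert z (A.image φ)) where
  mono A B hAB _ := h.mono (Finset.insert_subset_insert _ (Finset.image_subset_image hAB))
  glue A B _ _ hAB := by
    obtain ⟨x, hx⟩ := hAB
    rw [Finset.mem_inter] at hx
    have := h.glue (A := insert z (A.image φ)) (B := B.image φ) ⟨φ x, Finset.mem_inter.2
      ⟨Finset.mem_insert_of_mem (Finset.mem_image_of_mem _ hx.1),
        Finset.mem_image_of_mem _ hx.2⟩⟩
    rwa [Finset.insert_union, ← Finset.image_union] at this
  zero := by simp [h.singleton]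
  sub A B _ _ := by
    have := h.glue (A := insert z (A.image φ)) (B := insert z (B.image φ)) ⟨z, by simp⟩
    rwa [Finset.insert_union, Finset.union_insert, Finset.insert_idem,
      ← Finset.image_union] at this
  tri A B _ _ := by
    have := h.glue (A := insert z (A.image φ)) (B := insert z (B.image φ)) ⟨z, by simp⟩
    refine (h.mono ?_).trans this
    rw [Finset.image_union]
    exact Finset.union_subset_union (Finset.subset_insert _ _) (Finset.subset_insert _ _)

theorem IsSemidiversity.katOn {X : Type u} [DecidableEq X]
    {δ : Finset X → ℝ} (h : IsSemidiversity δ) (z : X) (F : Finset X) :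
    KatOn δ F fun A => δ (insert z A) :=
  (h.katOn_comap id z F).congr (by simp) (by simp)

/-- The set function on `X ∪ {z}` that is `δ` on subsets of `F`, and `f (A ∩ F)` on every other
set `A`: points outside `F` are identified with `z`. -/
def adjoin {X : Type*} [DecidableEq X] (δ : Finset X → ℝ) (F : Finset X) (f : Finset X → ℝ)
    (S : Finset (Option X)) : ℝ :=
  if S ⊆ F.map Function.Embedding.some then δ (Finset.eraseNone S)
  else f (Finset.eraseNone S ∩ F)

theorem adjoin_of_subset {X : Type*} [DecidableEq X] {δ f : Finset X → ℝ} {F A : Finset X}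
    (hA : A ⊆ F) : adjoin δ F f (A.image some) = δ A := by
  have h1 : A.image some = A.map Function.Embedding.some := by
    ext; simp
  rw [h1, adjoin, if_pos (Finset.map_subset_map.2 hA)]
  simp

/-- The point `o` may be `none` or any point outside `F`. The second possibility lets the next
natural number play the role of the new point. -/
theorem adjoin_insert {X : Type*} [DecidableEq X] {δ f : Finset X → ℝ} {F A : Finset X}
    (hA : A ⊆ F) {o : Option X} (ho : ∀ x ∈ F, o ≠ some x) :
    adjoin δ F f (insert o (A.image some)) = f A := by
  rw [adjoin, if_neg]
  · congr 1
    ext x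
    simp only [Finset.mem_inter, Finset.mem_eraseNone, Finset.mem_insert, Finset.mem_image,
      Option.some.injEq, exists_eq_right]
    constructor
    · rintro ⟨h | h, hx⟩
      · exact absurd h.symm (ho x hx)
      · exact h
    · exact fun h => ⟨Or.inr h, hA h⟩
  · intro h
    have := h (Finset.mem_insert_self _ _)
    rw [Finset.mem_map] at this
    obtain ⟨x, hx, rfl⟩ := this
    exact ho x hx rfl

/-- A set not contained in `F` counts as containing the new point. Gluing two sets inside `F` is
gluing for δ, one inside and one outside is `glue`, two outside is `sub`; `tri` enters through
`KatOn.le` in the proof of monotonicity. -/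
theorem KatOn.isSemidiversity_adjoin {X : Type u} [DecidableEq X] {δ f : Finset X → ℝ}
    {F : Finset X} (h : KatOn δ F f) (hδ : IsSemidiversity δ) :
    IsSemidiversity (adjoin δ F f) := by
  have hsub : ∀ {S : Finset (Option X)}, S ⊆ F.map Function.Embedding.some →
      Finset.eraseNone S ⊆ F := by
    intro S hS x hx
    have := hS (Finset.mem_eraseNone.1 hx)
    simpa using this
  have hmem : ∀ {S T : Finset (Option X)}, S ⊆ F.map Function.Embedding.some → (S ∩ T).Nonempty →
      ∃ x ∈ F, x ∈ Finset.eraseNone S ∧ x ∈ Finset.eraseNone T := by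
    rintro S T hS ⟨o, ho⟩
    rw [Finset.mem_inter] at ho
    have := hS ho.1
    rw [Finset.mem_map] at this
    obtain ⟨x, hx, rfl⟩ := this
    exact ⟨x, hx, Finset.mem_eraseNone.2 ho.1, Finset.mem_eraseNone.2 ho.2⟩
  have hun : ∀ S T : Finset (Option X), Finset.eraseNone (S ∪ T) =
      Finset.eraseNone S ∪ Finset.eraseNone T := by
    intro S T; ext x; simp
  refine .of_glue ?_ ?_ ?_ ?_
  · simp [adjoin, hδ.empty]
  · intro o
    rw [adjoin]
    split_ifs with h1
    · exact hδ.eq_zero _ (by cases o <;> simp [Finset.card_le_one])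
    · have : Finset.eraseNone {o} ∩ F = ∅ := by
        rw [Finset.eq_empty_iff_forall_notMem]
        intro x hx
        simp only [Finset.mem_inter, Finset.mem_eraseNone, Finset.mem_singleton] at hx
        apply h1
        rw [← hx.1]
        simpa using hx.2
      rw [this, h.zero]
  · intro S T hST
    have hST' := (Finset.eraseNone : Finset (Option X) →o Finset X).monotone hST
    rw [adjoin, adjoin]
    split_ifs with h1 h2 h2
    · exact hδ.mono hST'
    · refine (h.le (hsub h1)).trans (h.mono _ _ ?_ Finset.inter_subset_right)
      exact Finset.subset_inter hST' (hsub h1)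
    · exact absurd (hST.trans h2) h1
    · exact h.mono _ _ (Finset.inter_subset_inter_right hST') Finset.inter_subset_right
  · intro S T hST
    simp only [adjoin, hun, Finset.union_subset_iff]
    by_cases h1 : S ⊆ F.map Function.Embedding.some <;>
      by_cases h2 : T ⊆ F.map Function.Embedding.some
    · obtain ⟨x, _, h3⟩ := hmem h1 hST
      simp only [h1, h2, and_self, if_true]
      exact hδ.glue ⟨x, Finset.mem_inter.2 h3⟩
    · obtain ⟨x, hx, h3⟩ := hmem h1 hST
      simp only [h1, h2, and_false, if_true, if_false]
      rw [Finset.union_inter_distrib_right, Finset.inter_eq_left.2 (hsub h1), Finset.union_comm,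
        add_comm]
      exact h.glue _ _ Finset.inter_subset_right (hsub h1)
        ⟨x, by simp only [Finset.mem_inter]; tauto⟩
    · rw [Finset.inter_comm] at hST
      obtain ⟨x, hx, h3⟩ := hmem h2 hST
      simp only [h1, h2, false_and, if_true, if_false]
      rw [Finset.union_inter_distrib_right, Finset.inter_eq_left.2 (hsub h2)]
      exact h.glue _ _ Finset.inter_subset_right (hsub h2)
        ⟨x, by simp only [Finset.mem_inter]; tauto⟩
    · simp only [h1, h2, and_self, if_false]
      rw [Finset.union_inter_distrib_right]
      exact h.sub _ _ Finset.inter_subset_right Finset.inter_subset_right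

/-! ## The minimal amalgamation of two one-point extensions -/

/-- `m A = δ (A ∪ {z₁, z₂})` for the minimal amalgamation of the one-point extensions of `F`
described by `f₁` and `f₂`. -/
structure IsMinGap {X : Type*} [DecidableEq X] (F : Finset X) (f₁ f₂ m : Finset X → ℝ) :
    Prop where
  left : ∀ A B, A ⊆ F → B ⊆ F → f₁ (A ∪ B) ≤ m A + f₂ B
  right : ∀ A B, A ⊆ F → B ⊆ F → f₂ (A ∪ B) ≤ m A + f₁ B
  min : ∀ A (r : ℝ), A ⊆ F → (∀ B, B ⊆ F → f₁ (A ∪ B) ≤ r + f₂ B) →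
    (∀ B, B ⊆ F → f₂ (A ∪ B) ≤ r + f₁ B) → m A ≤ r

theorem IsMinGap.symm {X : Type*} [DecidableEq X] {F : Finset X} {f₁ f₂ m : Finset X → ℝ}
    (h : IsMinGap F f₁ f₂ m) : IsMinGap F f₂ f₁ m :=
  ⟨h.right, h.left, fun A r hA h1 h2 => h.min A r hA h2 h1⟩

theorem exists_isMinGap {X : Type*} [DecidableEq X] (F : Finset X) (f₁ f₂ : Finset X → ℝ) :
    ∃ m, IsMinGap F f₁ f₂ m := by
  have hne : F.powerset.Nonempty := ⟨∅, by simp⟩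
  refine ⟨fun A => F.powerset.sup' hne fun B =>
    max (f₁ (A ∪ B) - f₂ B) (f₂ (A ∪ B) - f₁ B), ⟨?_, ?_, ?_⟩⟩
  · intro A B _ hB
    rw [← sub_le_iff_le_add]
    exact (le_max_left _ _).trans (Finset.le_sup' (fun B =>
      max (f₁ (A ∪ B) - f₂ B) (f₂ (A ∪ B) - f₁ B)) (Finset.mem_powerset.2 hB))
  · intro A B _ hB
    rw [← sub_le_iff_le_add]
    exact (le_max_right _ _).trans (Finset.le_sup' (fun B =>
      max (f₁ (A ∪ B) - f₂ B) (f₂ (A ∪ B) - f₁ B)) (Finset.mem_powerset.2 hB))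
  · intro A r _ h1 h2
    refine Finset.sup'_le _ _ fun B hB => ?_
    rw [Finset.mem_powerset] at hB
    exact max_le (by linarith [h1 B hB]) (by linarith [h2 B hB])

section

variable {F : Finset X} [DecidableEq X] {δ f₁ f₂ m : Finset X → ℝ}

theorem IsMinGap.le_left (h : IsMinGap F f₁ f₂ m) (h₂ : KatOn δ F f₂)
    {A : Finset X} (hA : A ⊆ F) : f₁ A ≤ m A := by
  simpa [h₂.zero] using h.left A ∅ hA (Finset.empty_subset _)

theorem IsMinGap.mono (h : IsMinGap F f₁ f₂ m) (h₁ : KatOn δ F f₁) (h₂ : KatOn δ F f₂)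
    {A B : Finset X} (hAB : A ⊆ B) (hB : B ⊆ F) : m A ≤ m B := by
  refine h.min A _ (hAB.trans hB) (fun C hC => ?_) fun C hC => ?_
  · exact (h₁.mono _ _ (Finset.union_subset_union_left hAB) (Finset.union_subset hB hC)).trans
      (h.left B C hB hC)
  · exact (h₂.mono _ _ (Finset.union_subset_union_left hAB) (Finset.union_subset hB hC)).trans
      (h.right B C hB hC)

/-- By the minimality of `m` it suffices to test the bound against each set C. There the inequality
for `f₁` or `f₂` at A ∪ C combines with the defining inequality of `m` at A. The neighbouring lemmas
follow the same pattern. -/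
theorem IsMinGap.glue (h : IsMinGap F f₁ f₂ m) (h₁ : KatOn δ F f₁) (h₂ : KatOn δ F f₂)
    {A B : Finset X} (hA : A ⊆ F) (hB : B ⊆ F) (hAB : (A ∩ B).Nonempty) :
    m (A ∪ B) ≤ m A + δ B := by
  have hne : ∀ C, ((A ∪ C) ∩ B).Nonempty := fun C =>
    hAB.mono (Finset.inter_subset_inter_right Finset.subset_union_left)
  refine h.min _ _ (Finset.union_subset hA hB) (fun C hC => ?_) fun C hC => ?_
  · rw [Finset.union_right_comm]
    linarith [h₁.glue (A ∪ C) B (Finset.union_subset hA hC) hB (hne C), h.left A C hA hC]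
  · rw [Finset.union_right_comm]
    linarith [h₂.glue (A ∪ C) B (Finset.union_subset hA hC) hB (hne C), h.right A C hA hC]

/-- This glues A ∪ {z₁} to B ∪ {z₂} along a common old point. The test set C is joined to B through
z₂ by `tri`, and B ∪ C is then attached to A, which it meets; the other half is symmetric. -/
theorem IsMinGap.le_add_of_inter (h : IsMinGap F f₁ f₂ m) (h₁ : KatOn δ F f₁)
    (h₂ : KatOn δ F f₂) {A B : Finset X} (hA : A ⊆ F) (hB : B ⊆ F) (hAB : (A ∩ B).Nonempty) :
    m (A ∪ B) ≤ f₁ A + f₂ B := by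
  refine h.min _ _ (Finset.union_subset hA hB) (fun C hC => ?_) fun C hC => ?_
  · rw [Finset.union_assoc]
    linarith [h₁.glue A (B ∪ C) hA (Finset.union_subset hB hC)
      (hAB.mono (Finset.inter_subset_inter_left Finset.subset_union_left)), h₂.tri B C hB hC]
  · rw [Finset.union_comm A, Finset.union_assoc]
    rw [Finset.inter_comm] at hAB
    linarith [h₂.glue B (A ∪ C) hB (Finset.union_subset hA hC)
      (hAB.mono (Finset.inter_subset_inter_left Finset.subset_union_left)), h₁.tri A C hA hC]

theorem IsMinGap.le_add_left (h : IsMinGap F f₁ f₂ m) (h₁ : KatOn δ F f₁)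
    {A B : Finset X} (hA : A ⊆ F) (hB : B ⊆ F) : m (A ∪ B) ≤ m A + f₁ B := by
  refine h.min _ _ (Finset.union_subset hA hB) (fun C hC => ?_) fun C hC => ?_
  · rw [Finset.union_right_comm]
    linarith [h₁.sub (A ∪ C) B (Finset.union_subset hA hC) hB, h.left A C hA hC]
  · rw [Finset.union_assoc]
    linarith [h.right A (B ∪ C) hA (Finset.union_subset hB hC), h₁.sub B C hB hC]

theorem IsMinGap.sub (h : IsMinGap F f₁ f₂ m) (h₁ : KatOn δ F f₁) (h₂ : KatOn δ F f₂)
    {A B : Finset X} (hA : A ⊆ F) (hB : B ⊆ F) : m (A ∪ B) ≤ m A + m B := by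
  refine h.min _ _ (Finset.union_subset hA hB) (fun C hC => ?_) fun C hC => ?_
  · rw [Finset.union_assoc]
    linarith [h₁.sub A (B ∪ C) hA (Finset.union_subset hB hC), h.le_left h₂ hA, h.left B C hB hC]
  · rw [Finset.union_assoc]
    linarith [h₂.sub A (B ∪ C) hA (Finset.union_subset hB hC), h.symm.le_left h₁ hA,
      h.right B C hB hC]

theorem IsMinGap.empty_le (h : IsMinGap F f₁ f₂ m) {r : ℝ}
    (hr : ∀ A, A ⊆ F → |f₁ A - f₂ A| ≤ r) : m ∅ ≤ r := by
  refine h.min _ _ (Finset.empty_subset _) (fun C hC => ?_) fun C hC => ?_ <;>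
  · rw [Finset.empty_union]
    linarith [abs_le.1 (hr C hC)]

end

/-- A one-point extension of `F` extends to one of `F ∪ {y}`, with the new point as close to `y`
as the two extensions of `F` by these points allow. -/
theorem KatOn.exists_insert {X : Type u} [DecidableEq X] {δ f : Finset X → ℝ} {F : Finset X}
    (hδ : IsSemidiversity δ) (hf : KatOn δ F f) (y : X) :
    ∃ f', KatOn δ (insert y F) f' ∧ (∀ A, A ⊆ F → f' A = f A) ∧
      ∀ r, (∀ A, A ⊆ F → |δ (insert y A) - f A| ≤ r) → f' {y} ≤ r := by
  by_cases hy : y ∈ F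
  · refine ⟨f, by rwa [Finset.insert_eq_of_mem hy], fun _ _ => rfl, fun r hr => ?_⟩
    have := hr {y} (by simpa using hy)
    rw [Finset.insert_eq_of_mem (by simp), hδ.singleton] at this
    linarith [abs_le.1 this]
  have hg := hδ.katOn y F
  obtain ⟨m, hm⟩ := exists_isMinGap F (fun A => δ (insert y A)) f
  have her : ∀ {A}, A ⊆ insert y F → A.erase y ⊆ F := fun hA => by rwa [← Finset.subset_insert_iff]
  have hnot : ∀ {A}, A ⊆ insert y F → y ∉ A → A ⊆ F := fun hA h =>
    (Finset.subset_insert_iff_of_notMem h).1 hA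
  have hnotF : ∀ {A}, A ⊆ F → y ∉ A := fun hA h => hy (hA h)
  have hins : ∀ {A}, y ∈ A → δ (insert y (A.erase y)) = δ A := fun h => by
    rw [Finset.insert_erase h]
  have heu : ∀ {A B : Finset X}, y ∉ B → (A ∪ B).erase y = A.erase y ∪ B := fun h => by
    rw [Finset.erase_union_distrib, Finset.erase_eq_of_notMem h]
  have hne : ∀ {A B : Finset X}, (A ∩ B).Nonempty → y ∉ B → (A.erase y ∩ B).Nonempty := by
    rintro A B ⟨x, hx⟩ hyB
    rw [Finset.mem_inter] at hx
    exact ⟨x, Finset.mem_inter.2 ⟨Finset.mem_erase.2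
      ⟨fun h => hyB (h ▸ hx.2), hx.1⟩, hx.2⟩⟩
  -- Here `m A` is the diversity of A together with y and the new point in the minimal amalgam. Each
  -- axiom splits by whether y belongs to the sets involved, and becomes one of the inequalities for
  -- `m`, `f` or δ.
  refine ⟨fun A => if y ∈ A then m (A.erase y) else f A, ⟨⟨?_, ?_⟩, ?_, ?_, ?_⟩, ?_, ?_⟩
  · intro A B hAB hB
    have hA := hAB.trans hB
    split_ifs with h1 h2 h2
    · exact hm.mono hg hf (Finset.erase_subset_erase _ hAB) (her hB)
    · exact absurd (hAB h1) h2
    · refine (hm.symm.le_left hg (hnot hA h1)).trans (hm.mono hg hf ?_ (her hB))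
      rw [← Finset.erase_eq_of_notMem h1]
      exact Finset.erase_subset_erase _ hAB
    · exact hf.mono _ _ hAB (hnot hB h2)
  · intro A B hA hB hAB
    simp only [Finset.mem_union]
    by_cases h1 : y ∈ A <;> by_cases h2 : y ∈ B
    · simp only [h1, h2, or_self, if_true, Finset.erase_union_distrib]
      have := hm.le_add_left hg (her hA) (her hB)
      rwa [hins h2] at this
    · simp only [h1, h2, or_false, if_true, heu h2]
      exact hm.glue hg hf (her hA) (hnot hB h2) (hne hAB h2)
    · simp only [h1, h2, or_true, if_true, if_false]
      rw [Finset.union_comm, heu h1]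
      have := hm.le_add_of_inter hg hf (her hB) (hnot hA h1)
        (hne (by rwa [Finset.inter_comm] at hAB) h1)
      rw [hins h2] at this
      linarith
    · simp only [h1, h2, or_self, if_false]
      exact hf.glue _ _ (hnot hA h1) (hnot hB h2) hAB
  · simp [hf.zero]
  · intro A B hA hB
    simp only [Finset.mem_union]
    by_cases h1 : y ∈ A <;> by_cases h2 : y ∈ B
    · simp only [h1, h2, or_self, if_true, Finset.erase_union_distrib]
      exact hm.sub hg hf (her hA) (her hB)
    · simp only [h1, h2, or_false, if_true, if_false, heu h2]
      exact hm.symm.le_add_left hf (her hA) (hnot hB h2)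
    · simp only [h1, h2, or_true, if_true, if_false]
      rw [Finset.union_comm, heu h1, add_comm]
      exact hm.symm.le_add_left hf (her hB) (hnot hA h1)
    · simp only [h1, h2, or_self, if_false]
      exact hf.sub _ _ (hnot hA h1) (hnot hB h2)
  · intro A B hA hB
    by_cases h1 : y ∈ A <;> by_cases h2 : y ∈ B
    · simp only [h1, h2, if_true]
      have h3 := hδ.glue (A := A) (B := B) ⟨y, Finset.mem_inter.2 ⟨h1, h2⟩⟩
      have h4 := hm.le_left hf (her hA)
      have h5 := hm.le_left hf (her hB)
      rw [hins h1] at h4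
      rw [hins h2] at h5
      linarith
    · simp only [h1, h2, if_true, if_false]
      have := hm.left (A.erase y) B (her hA) (hnot hB h2)
      rwa [← Finset.insert_union, Finset.insert_erase h1] at this
    · simp only [h1, h2, if_true, if_false]
      have := hm.left (B.erase y) A (her hB) (hnot hA h1)
      rw [← Finset.insert_union, Finset.insert_erase h2] at this
      rw [Finset.union_comm]
      linarith
    · simp only [h1, h2, if_false]
      exact hf.tri _ _ (hnot hA h1) (hnot hB h2)
  · intro A hA
    simp only [hnotF hA, if_false]
  · intro r hr
    simp only [Finset.mem_singleton, if_true, Finset.erase_singleton]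
    exact hm.empty_le hr

theorem KatOn.exists_union {X : Type u} [DecidableEq X] {δ f : Finset X → ℝ} {F : Finset X}
    (hδ : IsSemidiversity δ) (hf : KatOn δ F f) (G : Finset X) :
    ∃ f', KatOn δ (G ∪ F) f' ∧ ∀ A, A ⊆ F → f' A = f A := by
  induction G using Finset.induction_on with
  | empty => exact ⟨f, by rwa [Finset.empty_union], fun _ _ => rfl⟩
  | insert y G _ ih =>
    obtain ⟨f', h1, h2⟩ := ih
    obtain ⟨f'', h3, h4, _⟩ := h1.exists_insert hδ y
    refine ⟨f'', by rwa [Finset.insert_union], fun A hA => ?_⟩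
    rw [h4 A (hA.trans Finset.subset_union_right), h2 A hA]

end Semidiversity

/-! ### The explicit one-point amalgamation: semidiversity, minimality, distance of the two new
points -/

section OnePointAmalgam

variable {X : Type u}

theorem IsSemidiversity.katOn_insertNone [DecidableEq X] {δ : Finset (Option X) → ℝ}
    (h : IsSemidiversity δ) (F : Finset X) :
    KatOn (fun A => δ (A.map Function.Embedding.some)) F fun A => δ (Finset.insertNone A) :=
  (h.katOn_comap some none F).congr
    (fun A _ => by congr 1; ext; simp)
    (fun A _ => by congr 1; ext o; cases o <;> simp)

/-- The displayed formula enters the arguments below only through this universal property. -/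
theorem isMinGap_iSup [Fintype X] [DecidableEq X] (f₁ f₂ : Finset X → ℝ) :
    IsMinGap Finset.univ f₁ f₂ fun A =>
      max (⨆ B : Finset X, (f₁ (A ∪ B) - f₂ B)) (⨆ C : Finset X, (f₂ (A ∪ C) - f₁ C)) where
  left A B _ _ := by
    rw [← sub_le_iff_le_add]
    exact (le_ciSup (f := fun B : Finset X => f₁ (A ∪ B) - f₂ B)
      (Set.finite_range _).bddAbove B).trans (le_max_left _ _)
  right A B _ _ := by
    rw [← sub_le_iff_le_add]
    exact (le_ciSup (f := fun B : Finset X => f₂ (A ∪ B) - f₁ B)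
      (Set.finite_range _).bddAbove B).trans (le_max_right _ _)
  min A r _ h1 h2 := max_le
    (ciSup_le fun B => by linarith [h1 B (Finset.subset_univ _)])
    (ciSup_le fun B => by linarith [h2 B (Finset.subset_univ _)])

theorem toLeft_image_inclPt [DecidableEq X] (b : Bool) (A : Finset (Option X)) :
    (A.image (inclPt b)).toLeft = Finset.eraseNone A := by
  ext x
  simp only [Finset.mem_toLeft, Finset.mem_image, Finset.mem_eraseNone]
  constructor
  · rintro ⟨_ | y, hy, h⟩
    · simp [inclPt] at h
    · simp only [inclPt, Option.elim_some, Sum.inl.injEq] at h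
      rwa [← h]
  · exact fun h => ⟨some x, h, rfl⟩

theorem inr_mem_image_inclPt [DecidableEq X] (b c : Bool) (A : Finset (Option X)) :
    Sum.inr c ∈ A.image (inclPt b) ↔ c = b ∧ none ∈ A := by
  simp only [Finset.mem_image]
  constructor
  · rintro ⟨_ | y, hy, h⟩
    · simp only [inclPt, Option.elim_none, Sum.inr.injEq] at h
      exact ⟨h.symm, hy⟩
    · simp [inclPt] at h
  · rintro ⟨rfl, h⟩
    exact ⟨none, h, rfl⟩

theorem map_some_eraseNone_of_notMem {A : Finset (Option X)} (h : none ∉ A) :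
    (Finset.eraseNone A).map Function.Embedding.some = A := by
  classical
  rw [Finset.map_some_eraseNone, Finset.erase_eq_of_notMem h]

theorem isSemidiversity_minAmalgam [Finite X] {δ₁ δ₂ : Finset (Option X) → ℝ}
    (h₁ : IsSemidiversity δ₁) (h₂ : IsSemidiversity δ₂)
    (h : ∀ A : Finset X, δ₁ (A.map Function.Embedding.some) = δ₂ (A.map Function.Embedding.some)) :
    IsSemidiversity (minAmalgam δ₁ δ₂) := by
  classical
  have := Fintype.ofFinite X
  have k₁ := h₁.katOn_insertNone Finset.univ
  have k₂ := (h₂.katOn_insertNone Finset.univ).congr (fun A _ => (h A).symm) (fun _ _ => rfl)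
  have hm := isMinGap_iSup (fun A => δ₁ (Finset.insertNone A)) (fun A => δ₂ (Finset.insertNone A))
  set f₁ : Finset X → ℝ := fun A => δ₁ (Finset.insertNone A) with hf₁
  set f₂ : Finset X → ℝ := fun A => δ₂ (Finset.insertNone A) with hf₂
  set m : Finset X → ℝ := fun A =>
      max (⨆ B : Finset X, (f₁ (A ∪ B) - f₂ B)) (⨆ C : Finset X, (f₂ (A ∪ C) - f₁ C)) with hmdef
  set δ : Finset X → ℝ := fun A => δ₁ (A.map Function.Embedding.some) with hδ
  have sδ : IsSemidiversity δ := by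
    have := h₁.comap (some : X → Option X)
    convert this using 2 with A
    exact congrArg δ₁ (by ext; simp)
  have hval : ∀ S, minAmalgam δ₁ δ₂ S = if Sum.inr false ∈ S then
      (if Sum.inr true ∈ S then m S.toLeft else f₁ S.toLeft)
      else (if Sum.inr true ∈ S then f₂ S.toLeft else δ S.toLeft) := fun S => rfl
  have hu : ∀ A : Finset X, A ⊆ Finset.univ := Finset.subset_univ
  refine .of_glue ?_ ?_ ?_ ?_
  · have : (∅ : Finset (X ⊕ Bool)).toLeft = ∅ := by ext; simp
    simpa [hval, this] using sδ.empty
  · rintro (x | b)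
    · have : ({Sum.inl x} : Finset (X ⊕ Bool)).toLeft = {x} := by ext; simp
      simp [hval, this, sδ.singleton]
    · have : ({Sum.inr b} : Finset (X ⊕ Bool)).toLeft = ∅ := by ext; simp
      cases b <;> simp [hval, this, k₁.zero, k₂.zero]
  · intro S T hST
    have hL : S.toLeft ⊆ T.toLeft := Finset.toLeft_subset_toLeft hST
    rw [hval, hval]
    split_ifs with a1 a2 a3 a4 a5 a6 a7 a8 a9 a10 a11
    all_goals first
      | exact hm.mono k₁ k₂ hL (hu _)
      | exact k₁.mono _ _ hL (hu _)
      | exact k₂.mono _ _ hL (hu _)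
      | exact sδ.mono hL
      | exact (k₁.mono _ _ hL (hu _)).trans (hm.le_left k₂ (hu _))
      | exact (k₂.mono _ _ hL (hu _)).trans (hm.symm.le_left k₁ (hu _))
      | exact (k₁.le (hu _)).trans ((k₁.mono _ _ hL (hu _)).trans (hm.le_left k₂ (hu _)))
      | exact (k₁.le (hu _)).trans (k₁.mono _ _ hL (hu _))
      | exact (k₂.le (hu _)).trans (k₂.mono _ _ hL (hu _))
      | exact absurd (hST a1) ‹_›
      | exact absurd (hST a2) ‹_›
      | exact absurd (hST ‹Sum.inr true ∈ S›) ‹_›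
  · intro S T hST
    have hin : (S.toLeft ∩ T.toLeft).Nonempty ∨ (Sum.inr false ∈ S ∧ Sum.inr false ∈ T) ∨
        (Sum.inr true ∈ S ∧ Sum.inr true ∈ T) := by
      obtain ⟨x | b, hx⟩ := hST
      · left
        exact ⟨x, by simpa using hx⟩
      · right
        rw [Finset.mem_inter] at hx
        cases b
        · exact Or.inl hx
        · exact Or.inr hx
    have hLR : (S ∪ T).toLeft = S.toLeft ∪ T.toLeft := by ext; simp
    have hc := Finset.union_comm S.toLeft T.toLeft
    have hi := Finset.inter_comm S.toLeft T.toLeft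
    have hA := hu S.toLeft
    have hB := hu T.toLeft
    rw [hval, hval, hval, hLR]
    simp only [Finset.mem_union]
    generalize S.toLeft = A at *
    generalize T.toLeft = B at *
    -- Sixteen cases, by which of z₁ and z₂ lie in S and in T. If they share neither, `hin` provides
    -- a common point in X.
    by_cases s1 : Sum.inr false ∈ S <;> by_cases s2 : Sum.inr true ∈ S <;>
      by_cases t1 : Sum.inr false ∈ T <;> by_cases t2 : Sum.inr true ∈ T <;>
      simp only [s1, s2, t1, t2, or_self, or_true, or_false, if_true, if_false, and_self,
        and_true, and_false] at hin ⊢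
    · exact hm.sub k₁ k₂ hA hB
    · exact hm.le_add_left k₁ hA hB
    · exact hm.symm.le_add_left k₂ hA hB
    · exact hm.glue k₁ k₂ hA hB hin
    · rw [hc, add_comm]; exact hm.le_add_left k₁ hB hA
    · exact k₁.sub A B hA hB
    · exact hm.le_add_of_inter k₁ k₂ hA hB hin
    · exact k₁.glue A B hA hB hin
    · rw [hc, add_comm]; exact hm.symm.le_add_left k₂ hB hA
    · exact hm.symm.le_add_of_inter k₂ k₁ hA hB hin
    · exact k₂.sub A B hA hB
    · exact k₂.glue A B hA hB hin
    · rw [hi] at hin; rw [hc, add_comm]; exact hm.glue k₁ k₂ hB hA hin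
    · rw [hi] at hin; rw [hc, add_comm]; exact k₁.glue B A hB hA hin
    · rw [hi] at hin; rw [hc, add_comm]; exact k₂.glue B A hB hA hin
    · exact sδ.glue hin

theorem isOnePointAmalgam_minAmalgam [Finite X] {δ₁ δ₂ : Finset (Option X) → ℝ}
    (h₁ : IsSemidiversity δ₁) (h₂ : IsSemidiversity δ₂)
    (h : ∀ A : Finset X, δ₁ (A.map Function.Embedding.some) = δ₂ (A.map Function.Embedding.some)) :
    IsOnePointAmalgam δ₁ δ₂ (minAmalgam δ₁ δ₂) where
  semi := isSemidiversity_minAmalgam h₁ h₂ h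
  left A := by
    classical
    rw [minAmalgam]
    simp only [inr_mem_image_inclPt, toLeft_image_inclPt]
    by_cases hA : none ∈ A
    · simp [hA]
    · simp [hA]
  right A := by
    classical
    rw [minAmalgam]
    simp only [inr_mem_image_inclPt, toLeft_image_inclPt]
    by_cases hA : none ∈ A
    · simp [hA]
    · have := h (Finset.eraseNone A)
      rw [map_some_eraseNone_of_notMem hA] at this
      simp [hA, this]

/-- In any amalgam, A ∪ B ∪ {z₁} is covered by A ∪ {z₁, z₂} and B ∪ {z₂}, which meet in z₂. Gluing
these gives the inequalities whose least solution is the minimal amalgam. -/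
theorem minAmalgam_le [Finite X] {δ₁ δ₂ : Finset (Option X) → ℝ}
    {γ : Finset (X ⊕ Bool) → ℝ} (hγ : IsOnePointAmalgam δ₁ δ₂ γ) (S : Finset (X ⊕ Bool)) :
    minAmalgam δ₁ δ₂ S ≤ γ S := by
  classical
  have := Fintype.ofFinite X
  have hleft : ∀ A : Finset (Option X), γ (A.image (inclPt false)) = δ₁ A := fun A => by
    rw [← hγ.left A]
  have hright : ∀ A : Finset (Option X), γ (A.image (inclPt true)) = δ₂ A := fun A => by
    rw [← hγ.right A]
  have hm := isMinGap_iSup (fun A => δ₁ (Finset.insertNone A)) (fun A => δ₂ (Finset.insertNone A))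
  have hmemS : ∀ {b : Bool} {A : Finset (Option X)}, Sum.inr b ∈ S →
      Finset.eraseNone A ⊆ S.toLeft → A.image (inclPt b) ⊆ S := by
    intro b A hb hA x hx
    obtain ⟨_ | y, hy, rfl⟩ := Finset.mem_image.1 hx
    · exact hb
    · exact Finset.mem_toLeft.1 (hA (Finset.mem_eraseNone.2 hy))
  rw [minAmalgam]
  split_ifs with h1 h2 h2
  · refine hm.min S.toLeft _ (Finset.subset_univ _) (fun B _ => ?_) fun B _ => ?_
    · rw [← hleft, ← hright]
      refine (hγ.semi.mono ?_).trans (hγ.semi.glue ⟨Sum.inr true, Finset.mem_inter.2 ⟨h2, ?_⟩⟩)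
      · intro x hx
        obtain ⟨_ | y, hy, rfl⟩ := Finset.mem_image.1 hx
        · exact Finset.mem_union_left _ h1
        · simp only [Finset.some_mem_insertNone, Finset.mem_union, Finset.mem_toLeft] at hy
          rcases hy with hy | hy
          · exact Finset.mem_union_left _ hy
          · exact Finset.mem_union_right _ (Finset.mem_image.2 ⟨some y, by simpa using hy, rfl⟩)
      · exact (inr_mem_image_inclPt _ _ _).2 ⟨rfl, by simp⟩
    · rw [← hleft, ← hright]
      refine (hγ.semi.mono ?_).trans (hγ.semi.glue ⟨Sum.inr false, Finset.mem_inter.2 ⟨h1, ?_⟩⟩)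
      · intro x hx
        obtain ⟨_ | y, hy, rfl⟩ := Finset.mem_image.1 hx
        · exact Finset.mem_union_left _ h2
        · simp only [Finset.some_mem_insertNone, Finset.mem_union, Finset.mem_toLeft] at hy
          rcases hy with hy | hy
          · exact Finset.mem_union_left _ hy
          · exact Finset.mem_union_right _ (Finset.mem_image.2 ⟨some y, by simpa using hy, rfl⟩)
      · exact (inr_mem_image_inclPt _ _ _).2 ⟨rfl, by simp⟩
  · rw [← hleft]
    exact hγ.semi.mono (hmemS h1 (by simp))
  · rw [← hright]
    exact hγ.semi.mono (hmemS h2 (by simp))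
  · rw [← hleft]
    refine hγ.semi.mono fun x hx => ?_
    obtain ⟨o, hy, rfl⟩ := Finset.mem_image.1 hx
    obtain ⟨y, hy, rfl⟩ := Finset.mem_map.1 hy
    simpa [inclPt] using hy

theorem minAmalgam_univ_inr [Finite X] (δ₁ δ₂ : Finset (Option X) → ℝ) :
    minAmalgam δ₁ δ₂ (Finset.univ.map Function.Embedding.inr) =
      ⨆ A : Finset X, |δ₁ (Finset.insertNone A) - δ₂ (Finset.insertNone A)| := by
  classical
  have := Fintype.ofFinite X
  have hm := isMinGap_iSup (fun A => δ₁ (Finset.insertNone A)) (fun A => δ₂ (Finset.insertNone A))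
  have h0 : (Finset.univ.map Function.Embedding.inr : Finset (X ⊕ Bool)).toLeft = ∅ := by
    ext; simp
  have hb : ∀ b : Bool,
      Sum.inr b ∈ (Finset.univ.map Function.Embedding.inr : Finset (X ⊕ Bool)) := by
    intro b
    simp
  rw [minAmalgam, if_pos (hb _), if_pos (hb _), h0]
  have hbdd : BddAbove (Set.range fun A : Finset X =>
      |δ₁ (Finset.insertNone A) - δ₂ (Finset.insertNone A)|) := (Set.finite_range _).bddAbove
  refine le_antisymm (hm.empty_le fun A _ => le_ciSup hbdd A) (ciSup_le fun A => ?_)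
  have h1 := hm.left ∅ A (Finset.subset_univ _) (Finset.subset_univ _)
  have h2 := hm.right ∅ A (Finset.subset_univ _) (Finset.subset_univ _)
  rw [Finset.empty_union] at h1 h2
  rw [abs_le]
  constructor <;> linarith

theorem IsDiversity.of_pair [DecidableEq X] {δ : Finset X → ℝ} (h : IsSemidiversity δ)
    (h0 : ∀ x y, δ {x, y} = 0 → x = y) : IsDiversity δ where
  toIsSemidiversity := h
  card_le_one A hA := by
    rw [Finset.card_le_one]
    intro x hx y hy
    refine h0 x y (le_antisymm (hA ▸ h.mono ?_) (h.nonneg _))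
    intro z hz
    rw [Finset.mem_insert, Finset.mem_singleton] at hz
    rcases hz with rfl | rfl <;> assumption

theorem IsDiversity.eq_of_pair [DecidableEq X] {δ : Finset X → ℝ} (h : IsDiversity δ)
    {x y : X} (hxy : δ {x, y} = 0) : x = y :=
  Finset.card_le_one.1 (h.card_le_one _ hxy) x (by simp) y (by simp)

/-- The only pair of distinct points not contained in one of the two given diversities is {z₁, z₂}.
-/
theorem IsOnePointAmalgam.isDiversity {δ₁ δ₂ : Finset (Option X) → ℝ}
    {γ : Finset (X ⊕ Bool) → ℝ} (hγ : IsOnePointAmalgam δ₁ δ₂ γ) (h₁ : IsDiversity δ₁)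
    (h₂ : IsDiversity δ₂) (h : γ (Finset.univ.map Function.Embedding.inr) ≠ 0) :
    IsDiversity γ := by
  classical
  have hleft : ∀ o p, γ {inclPt false o, inclPt false p} = 0 → o = p := fun o p hop => by
    refine h₁.eq_of_pair ?_
    rw [← hγ.left, ← hop]
    congr 1
    ext; simp
  have hright : ∀ o p, γ {inclPt true o, inclPt true p} = 0 → o = p := fun o p hop => by
    refine h₂.eq_of_pair ?_
    rw [← hγ.right, ← hop]
    congr 1
    ext; simp
  have hft : (Finset.univ.map Function.Embedding.inr : Finset (X ⊕ Bool)) =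
      {Sum.inr false, Sum.inr true} := by
    ext x
    rcases x with x | _ | _ <;> simp
  refine .of_pair hγ.semi ?_
  rintro (x | _ | _) (y | _ | _) hxy
  · exact congrArg Sum.inl (Option.some_injective _ (hleft (some x) (some y) hxy))
  · exact absurd (hleft (some x) none hxy) (by simp)
  · exact absurd (hright (some x) none hxy) (by simp)
  · exact absurd (hleft none (some y) hxy) (by simp)
  · rfl
  · exact absurd hxy (hft ▸ h)
  · exact absurd (hright none (some y) hxy) (by simp)
  · rw [Finset.pair_comm] at hxy
    exact absurd hxy (hft ▸ h)
  · rfl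

end OnePointAmalgam

open Filter Topology

/-- Dependent choice with an invariant `P` and a relation `Q` between successive terms. -/
theorem exists_seq_of_step {α : Type*} (P : ℕ → α → Prop) (Q : ℕ → α → α → Prop)
    (h0 : ∃ a, P 0 a) (hs : ∀ n a, P n a → ∃ b, P (n + 1) b ∧ Q n a b) :
    ∃ u : ℕ → α, ∀ n, P n (u n) ∧ Q n (u n) (u (n + 1)) := by
  obtain ⟨a, ha⟩ := h0
  choose! g hg using hs
  let u : ℕ → α := fun n => Nat.rec a (fun n b => g n b) n
  have hP : ∀ n, P n (u n) := by
    intro n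
    induction n with
    | zero => exact ha
    | succ n ih => exact (hg n _ ih).1
  exact ⟨u, fun n => ⟨hP n, (hg n _ (hP n)).2⟩⟩

/-! ### Extension properties: a countable model, its completion, and exact realisation -/

section Urysohn

/-- Every one-point extension of a finite subset is realised approximately. -/
def ApproxExt {X : Type*} [DecidableEq X] (δ : Finset X → ℝ) : Prop :=
  ∀ F f, KatOn δ F f → ∀ ε > 0, ∃ z, ∀ A, A ⊆ F → |δ (insert z A) - f A| ≤ ε

/-- Every one-point extension of a finite subset is realised. -/
def ExactExt {X : Type*} [DecidableEq X] (δ : Finset X → ℝ) : Prop :=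
  ∀ F f, KatOn δ F f → ∃ z, ∀ A, A ⊆ F → δ (insert z A) = f A

/-! ### A countable semidiversity with the approximate extension property -/

/-- The product of countably many lines is second countable, so each subset `K` is separable.
Approximation on the finitely many subsets of `F` is an open condition. -/
theorem exists_dense_seq (K : Set (Finset ℕ → ℝ)) :
    ∃ d : ℕ → Finset ℕ → ℝ, ∀ f ∈ K, ∀ (F : Finset ℕ), ∀ ε > 0,
      ∃ k, d k ∈ K ∧ ∀ A, A ⊆ F → |d k A - f A| < ε := by
  rcases K.eq_empty_or_nonempty with rfl | hK
  · exact ⟨fun _ => 0, fun f hf => absurd hf (Set.notMem_empty f)⟩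
  have : Nonempty K := hK.to_subtype
  refine ⟨fun k => (TopologicalSpace.denseSeq K k : K), fun f hf F ε hε => ?_⟩
  have hopen : IsOpen {g : K | ∀ A ∈ F.powerset, |g.1 A - f A| < ε} := by
    simp only [Set.ofPred_forall]
    refine isOpen_biInter_finset fun A _ => ?_
    have : Continuous fun g : K => |g.1 A - f A| :=
      (((continuous_apply A).comp continuous_subtype_val).sub continuous_const).abs
    exact isOpen_lt this continuous_const
  obtain ⟨k, hk⟩ := (TopologicalSpace.denseRange_denseSeq K).exists_mem_open hopen
    ⟨⟨f, hf⟩, by simpa using fun _ _ => hε⟩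
  exact ⟨k, Subtype.prop _, fun A hA => hk A (Finset.mem_powerset.2 hA)⟩

theorem exists_semidiversity_succ {δ : Finset ℕ → ℝ} (hδ : IsSemidiversity δ) (n : ℕ)
    (F : Finset ℕ) (g : Finset ℕ → ℝ) :
    ∃ δ', IsSemidiversity δ' ∧ (∀ A, A ⊆ Finset.range n → δ' A = δ A) ∧
      (F ⊆ Finset.range n → KatOn δ F g → ∀ A, A ⊆ F → δ' (insert n A) = g A) := by
  by_cases h : F ⊆ Finset.range n ∧ KatOn δ F g
  · obtain ⟨f', h1, h2⟩ := h.2.exists_union hδ (Finset.range n)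
    rw [Finset.union_eq_left.2 h.1] at h1
    -- Pulling back along `some` keeps the carrier ℕ: every number outside `range n`, in particular
    -- n itself, acts as the new point.
    refine ⟨_, (h1.isSemidiversity_adjoin hδ).comap some, fun A hA => adjoin_of_subset hA,
      fun _ _ A hA => ?_⟩
    rw [Finset.image_insert, adjoin_insert (hA.trans h.1), h2 A hA]
    intro x hx hnx
    rw [Option.some.injEq] at hnx
    simp [hnx] at hx
  · exact ⟨δ, hδ, fun _ _ => rfl, fun h1 h2 => absurd ⟨h1, h2⟩ h⟩

theorem exists_semidiversity_approxExt :
    ∃ δ : Finset ℕ → ℝ, IsSemidiversity δ ∧ ApproxExt δ := by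
  choose dn hdn using exists_dense_seq
  obtain ⟨g, hg⟩ := exists_surjective_nat (Finset ℕ × ℕ)
  -- Using only the second component of the pairing makes every task recur at arbitrarily late
  -- stages, hence at a stage when all of its set `F` is already present.
  let φ : ℕ → Finset ℕ × ℕ := fun n => g n.unpair.2
  obtain ⟨D, hD⟩ := exists_seq_of_step (fun _ (δ : Finset ℕ → ℝ) => IsSemidiversity δ)
    (fun n δ δ' => (∀ A, A ⊆ Finset.range n → δ' A = δ A) ∧
      ((φ n).1 ⊆ Finset.range n → KatOn δ (φ n).1 (dn {f | KatOn δ (φ n).1 f} (φ n).2) →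
        ∀ A, A ⊆ (φ n).1 → δ' (insert n A) = dn {f | KatOn δ (φ n).1 f} (φ n).2 A))
    ⟨fun _ => 0, ⟨fun _ => le_rfl, fun _ _ => rfl, fun _ _ _ _ => by simp⟩⟩
    (fun n δ hδ => exists_semidiversity_succ hδ n _ _)
  have hsemi : ∀ n, IsSemidiversity (D n) := fun n => (hD n).1
  have hle : ∀ {m n : ℕ}, m ≤ n → ∀ A, A ⊆ Finset.range m → D n A = D m A := by
    intro m n hmn A hA
    induction n, hmn using Nat.le_induction with
    | base => rfl
    | succ n hmn ih =>
      rw [(hD n).2.1 A (hA.trans (Finset.range_subset_range.2 hmn)), ih]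
  have hsup : ∀ A : Finset ℕ, A ⊆ Finset.range (A.sup id + 1) := fun A x hx =>
    Finset.mem_range.2 (Nat.lt_succ_of_le (Finset.le_sup (f := id) hx))
  let δ : Finset ℕ → ℝ := fun A => D (A.sup id + 1) A
  have hδ : ∀ n A, A ⊆ Finset.range n → δ A = D n A := by
    intro n A hA
    rw [← hle (le_max_left n (A.sup id + 1)) A hA, hle (le_max_right _ _) A (hsup A)]
  have hsδ : IsSemidiversity δ := by
    refine .of_glue (hsemi _).empty (fun x => (hsemi _).singleton x) (fun A B hAB => ?_)
      fun A B hAB => ?_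
    · rw [hδ _ A (hAB.trans (hsup B)), hδ _ B (hsup B)]
      exact (hsemi _).mono hAB
    · have h1 := hsup (A ∪ B)
      rw [hδ _ _ h1, hδ _ _ (Finset.subset_union_left.trans h1),
        hδ _ _ (Finset.subset_union_right.trans h1)]
      exact (hsemi _).glue hAB
  refine ⟨δ, hsδ, fun F f hf ε hε => ?_⟩
  obtain ⟨k, hk, hkf⟩ := hdn {f | KatOn δ F f} f hf F ε hε
  obtain ⟨m, hm⟩ := hg (F, k)
  let n := Nat.pair (F.sup id + 1) m
  have hn : φ n = (F, k) := by simp [φ, n, hm]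
  have hFn : F ⊆ Finset.range n :=
    (hsup F).trans (Finset.range_subset_range.2 (Nat.left_le_pair _ _))
  -- The dense sequence depends on the whole set of candidate extensions. Since `D n` and the limit
  -- δ agree on subsets of `F`, stage n used the same sequence.
  have hK : {f | KatOn (D n) F f} = {f | KatOn δ F f} := by
    ext f
    exact ⟨fun h => h.congr (fun A hA => (hδ n A (hA.trans hFn)).symm) (fun _ _ => rfl),
      fun h => h.congr (fun A hA => hδ n A (hA.trans hFn)) (fun _ _ => rfl)⟩
  have h1 := (hD n).2.2
  rw [hn] at h1
  simp only [hK] at h1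
  refine ⟨n, fun A hA => ?_⟩
  have h2 : insert n A ⊆ Finset.range (n + 1) :=
    Finset.insert_subset (by simp)
      ((hA.trans hFn).trans (Finset.range_subset_range.2 n.le_succ))
  rw [hδ (n + 1) _ h2, h1 hFn (by rw [← hK] at hk; rwa [← hK]) A hA]
  exact (hkf A hA).le

/-! ### Completion -/

theorem IsSemidiversity.of_tendsto {X : Type u} {d : ℕ → Finset X → ℝ} {δ : Finset X → ℝ}
    (hd : ∀ k, IsSemidiversity (d k)) (h : ∀ S, Tendsto (fun k => d k S) atTop (𝓝 (δ S))) :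
    IsSemidiversity δ where
  nonneg A := ge_of_tendsto' (h A) fun k => (hd k).nonneg A
  eq_zero A hA := tendsto_nhds_unique (h A) (by simp [(hd _).eq_zero A hA])
  triangle A B C hB := le_of_tendsto_of_tendsto' (h _) ((h _).add (h _))
    fun k => (hd k).triangle A B C hB

open Classical in
/-- The induced pseudometric of a semidiversity. -/
noncomputable abbrev IsSemidiversity.pseudoMetricSpace {X : Type u} {δ : Finset X → ℝ}
    (h : IsSemidiversity δ) : PseudoMetricSpace X where
  dist x y := δ {x, y}
  dist_self x := h.eq_zero _ (by simp)
  dist_comm x y := by rw [Finset.pair_comm]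
  dist_triangle x y z := by
    have := h.triangle {x} {y} {z} (by simp)
    rwa [← Finset.insert_eq, ← Finset.insert_eq, ← Finset.insert_eq] at this

theorem tendsto_const_mul_one_div_add_one (c : ℝ) :
    Tendsto (fun n : ℕ => c * (1 / ((n : ℝ) + 1))) atTop (𝓝 0) := by
  simpa using tendsto_one_div_add_atTop_nhds_zero_nat.const_mul c

open Classical in
theorem exists_diversity_completion {X : Type u} [Countable X] {δ : Finset X → ℝ}
    (hδ : IsSemidiversity δ) (hext : ApproxExt δ) :
    ∃ (M : Type u) (_ : MetricSpace M) (_ : CompleteSpace M)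
      (_ : TopologicalSpace.SeparableSpace M) (δM : Finset M → ℝ),
      IsSemidiversity δM ∧ (∀ x y, dist x y = δM {x, y}) ∧ ApproxExt δM := by
  let _ := hδ.pseudoMetricSpace
  have hdX : ∀ x y : X, dist x y = δ {x, y} := fun _ _ => rfl
  let M := UniformSpace.Completion X
  let ι : X → M := fun x => x
  have hι : DenseRange ι := UniformSpace.Completion.denseRange_coe
  have hdι : ∀ x y, dist (ι x) (ι y) = dist x y := UniformSpace.Completion.dist_eq
  have hex : ∀ (k : ℕ) (m : M), ∃ x, dist m (ι x) < 1 / ((k : ℝ) + 1) := fun k m =>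
    hι.exists_dist_lt m (by positivity)
  -- The diversity on the completion is the limit of δ along these approximating points; the
  -- Lipschitz estimate makes the values Cauchy.
  choose a ha using hex
  have hsum : ∀ (S : Finset M) (b c : M → X) (r : ℝ), (∀ m, dist (b m) (c m) ≤ r) →
      |δ (S.image b) - δ (S.image c)| ≤ S.card * r := by
    intro S b c r hr
    refine (hδ.abs_image_sub_le S b c).trans ?_
    rw [← nsmul_eq_mul]
    exact Finset.sum_le_card_nsmul _ _ _ fun m _ => hr m
  have haa : ∀ (k l N : ℕ) (m : M), N ≤ k → N ≤ l →
      dist (a k m) (a l m) ≤ 2 * (1 / ((N : ℝ) + 1)) := by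
    intro k l N m hk hl
    rw [← hdι]
    have h1 := dist_triangle_left (ι (a k m)) (ι (a l m)) m
    have h2 := Nat.one_div_le_one_div (α := ℝ) hk
    have h3 := Nat.one_div_le_one_div (α := ℝ) hl
    linarith [ha k m, ha l m]
  have hlim : ∀ S : Finset M, ∃ r, Tendsto (fun k => δ (S.image (a k))) atTop (𝓝 r) := by
    intro S
    refine cauchySeq_tendsto_of_complete (cauchySeq_of_le_tendsto_0
      (fun N : ℕ => S.card * 2 * (1 / ((N : ℝ) + 1))) (fun k l N hk hl => ?_)
      (tendsto_const_mul_one_div_add_one _))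
    rw [Real.dist_eq, mul_assoc]
    exact hsum S _ _ _ fun m => haa k l N m hk hl
  choose δM hδM using hlim
  have hsM : IsSemidiversity δM := .of_tendsto (fun k => hδ.comap (a k)) hδM
  have hconv : ∀ m, Tendsto (fun k => ι (a k m)) atTop (𝓝 m) := by
    intro m
    rw [tendsto_iff_dist_tendsto_zero]
    refine squeeze_zero (fun _ => dist_nonneg) (fun k => ?_)
      tendsto_one_div_add_atTop_nhds_zero_nat
    rw [dist_comm]
    exact (ha k m).le
  have hdist : ∀ x y, dist x y = δM {x, y} := by
    intro x y
    refine tendsto_nhds_unique (((hconv x).dist (hconv y))) ?_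
    convert hδM {x, y} using 2 with k
    rw [hdι, hdX, Finset.image_insert, Finset.image_singleton]
  have hres : ∀ S : Finset X, δM (S.image ι) = δ S := by
    intro S
    refine tendsto_nhds_unique (hδM _) ?_
    rw [tendsto_iff_dist_tendsto_zero]
    refine squeeze_zero (fun _ => dist_nonneg) (fun k => ?_)
      (tendsto_const_mul_one_div_add_one S.card)
    rw [Finset.image_image, Real.dist_eq]
    have h1 := hδ.abs_image_sub_le S (a k ∘ ι) id
    rw [Finset.image_id] at h1
    refine h1.trans ?_
    rw [← nsmul_eq_mul]
    refine Finset.sum_le_card_nsmul _ _ _ fun s _ => ?_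
    rw [← hdX, ← hdι, dist_comm]
    exact (ha k (ι s)).le
  refine ⟨M, inferInstance, inferInstance, ?_, δM, hsM, hdist, fun F f hf ε hε => ?_⟩
  · exact ⟨Set.range ι, Set.countable_range _, hι⟩
  obtain ⟨k, hk⟩ := exists_nat_one_div_lt (show 0 < ε / (3 * ((F.card : ℝ) + 1)) by positivity)
  let b : M → M := fun m => ι (a k m)
  have hsumb : ∀ A, A ⊆ F → ∑ m ∈ A, δM {m, b m} ≤ ε / 3 := by
    intro A hA
    have h1 : ∑ m ∈ A, δM {m, b m} ≤ A.card • (1 / ((k : ℝ) + 1)) :=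
      Finset.sum_le_card_nsmul _ _ _ fun m _ => by
        rw [← hdist]
        exact (ha k m).le
    have h2 : (A.card : ℝ) ≤ F.card + 1 := by
      have := Finset.card_le_card hA
      exact_mod_cast this.trans (Nat.le_succ _)
    rw [nsmul_eq_mul] at h1
    refine h1.trans ?_
    have h3 : (0 : ℝ) < F.card + 1 := by positivity
    calc (A.card : ℝ) * (1 / ((k : ℝ) + 1)) ≤ (F.card + 1) * (ε / (3 * ((F.card : ℝ) + 1))) := by
          gcongr
      _ = ε / 3 := by field_simp
  have himg : ∀ A : Finset M, A.image b = (A.image (a k)).image ι := fun A => by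
    rw [Finset.image_image]; rfl
  -- The extension is enlarged to cover approximants of the points of `F` and then realised over the
  -- approximants, inside X. Three errors of ε/3 arise: moving A to its approximants in `f'`, moving
  -- it in `δM`, and the realisation itself.
  obtain ⟨f', h1, h2⟩ := hf.exists_union hsM ((F.image (a k)).image ι)
  have h3 := ((h1.subset Finset.subset_union_left).comap).congr (fun A _ => hres A)
    (fun A _ => rfl)
  obtain ⟨z, hz⟩ := hext _ _ h3 (ε / 3) (by positivity)
  refine ⟨ι z, fun A hA => ?_⟩
  have hbF : A.image b ⊆ (F.image (a k)).image ι ∪ F := by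
    rw [himg]
    exact (Finset.image_subset_image (Finset.image_subset_image hA)).trans
      Finset.subset_union_left
  have hAF : A.image id ⊆ (F.image (a k)).image ι ∪ F := by
    rw [Finset.image_id]
    exact hA.trans Finset.subset_union_right
  have h4 := (h1.toGlueOn.abs_image_sub_le A id b hAF hbF).trans (hsumb A hA)
  have h5 := ((hsM.katOn (ι z) _).toGlueOn.abs_image_sub_le A id b hAF hbF).trans (hsumb A hA)
  have h6 := hz (A.image (a k)) (Finset.image_subset_image hA)
  rw [← hres, Finset.image_insert] at h6
  rw [Finset.image_id, himg, h2 A hA] at h4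
  rw [Finset.image_id, himg] at h5
  rw [abs_le] at *
  constructor <;> linarith

/-! ### From approximate to exact extensions -/

theorem ApproxExt.exactExt {M : Type u} [DecidableEq M] [MetricSpace M] [CompleteSpace M]
    {δ : Finset M → ℝ} (hδ : IsSemidiversity δ) (hdist : ∀ x y, dist x y = δ {x, y})
    (hext : ApproxExt δ) : ExactExt δ := by
  intro F f hf
  obtain ⟨z, hz⟩ := exists_seq_of_step
    (fun k z => ∀ A, A ⊆ F → |δ (insert z A) - f A| ≤ (1 / 2 : ℝ) ^ k)
    (fun k z z' => dist z z' ≤ 2 * (1 / 2 : ℝ) ^ k)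
    (by simpa using hext F f hf 1 one_pos)
    (by
      intro k z hz
      -- Since f' {z} ≤ 2^{-k}, approximating f' rather than f also keeps the next point near z: its
      -- distance is at most 2^{-k} + 2^{-(k+1)}, below the summable bound 2 · 2^{-k}.
      obtain ⟨f', h1, h2, h3⟩ := hf.exists_insert hδ z
      obtain ⟨z', hz'⟩ := hext _ _ h1 ((1 / 2 : ℝ) ^ (k + 1)) (by positivity)
      refine ⟨z', fun A hA => ?_, ?_⟩
      · rw [← h2 A hA]
        exact hz' A (hA.trans (Finset.subset_insert _ _))
      · have h4 := hz' {z} (by simp)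
        have h5 := h3 _ hz
        rw [dist_comm, hdist]
        rw [pow_succ] at h4
        have : (0 : ℝ) ≤ (1 / 2) ^ k := by positivity
        linarith [abs_le.1 h4])
  obtain ⟨w, hw⟩ := cauchySeq_tendsto_of_complete
    (cauchySeq_of_le_geometric (1 / 2) 2 (by norm_num) fun k => (hz k).2)
  refine ⟨w, fun A hA => ?_⟩
  have h1 : Tendsto (fun k => δ (insert (z k) A)) atTop (𝓝 (f A)) := by
    rw [tendsto_iff_dist_tendsto_zero]
    refine squeeze_zero (fun _ => dist_nonneg) (fun k => (hz k).1 A hA)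
      (tendsto_pow_atTop_nhds_zero_of_lt_one (by norm_num) (by norm_num))
  have h2 : Tendsto (fun k => δ (insert (z k) A)) atTop (𝓝 (δ (insert w A))) := by
    rw [tendsto_iff_dist_tendsto_zero] at hw ⊢
    refine squeeze_zero (fun _ => dist_nonneg) (fun k => ?_) hw
    rw [hdist, Real.dist_eq]
    exact hδ.abs_insert_sub_le A _ _
  exact tendsto_nhds_unique h2 h1

end Urysohn

/-! ### Back-and-forth with partial isomorphisms -/

section BackAndForth

open Classical in
/-- The relation `P` is a partial isomorphism between the diversities `δM` and `δN`. -/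
def PartialIso {M N : Type*} (δM : Finset M → ℝ) (δN : Finset N → ℝ) (P : Set (M × N)) : Prop :=
  ∀ Q : Finset (M × N), (Q : Set (M × N)) ⊆ P → δM (Q.image Prod.fst) = δN (Q.image Prod.snd)

theorem PartialIso.image_eq {M N : Type*} [DecidableEq M] [DecidableEq N] {δM : Finset M → ℝ}
    {δN : Finset N → ℝ} {P : Set (M × N)} (h : PartialIso δM δN P) {ι : Type*} (S : Finset ι)
    (p : ι → M × N) (hp : ∀ i ∈ S, p i ∈ P) :
    δM (S.image fun i => (p i).1) = δN (S.image fun i => (p i).2) := by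
  classical
  have := h (S.image p) (by
    intro q hq
    rw [Finset.mem_coe, Finset.mem_image] at hq
    obtain ⟨i, hi, rfl⟩ := hq
    exact hp i hi)
  convert this using 2 <;> (ext; simp)

theorem PartialIso.mono {M N : Type*} {δM : Finset M → ℝ} {δN : Finset N → ℝ}
    {P Q : Set (M × N)} (h : PartialIso δM δN Q) (hPQ : P ⊆ Q) : PartialIso δM δN P :=
  fun R hR => h R (hR.trans hPQ)

theorem PartialIso.swap {M N : Type*} {δM : Finset M → ℝ} {δN : Finset N → ℝ}
    {P : Set (M × N)} (h : PartialIso δM δN P) : PartialIso δN δM (Prod.swap '' P) := by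
  classical
  intro Q hQ
  have := h.image_eq Q Prod.swap (fun q hq => by
    obtain ⟨p, hp, rfl⟩ := hQ hq
    simpa using hp)
  simp only [Prod.fst_swap, Prod.snd_swap] at this
  convert this.symm using 2

theorem ExactExt.nonempty {M : Type*} [DecidableEq M] {δ : Finset M → ℝ} (h : ExactExt δ)
    (h0 : δ ∅ = 0) : Nonempty M := by
  obtain ⟨z, _⟩ := h ∅ (fun _ => 0)
    { mono := fun _ _ _ _ => le_rfl
      glue := fun A B hA _ hAB => by
        rw [Finset.subset_empty.1 hA, Finset.empty_inter] at hAB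
        exact absurd hAB Finset.not_nonempty_empty
      zero := rfl
      sub := fun _ _ _ _ => by simp
      tri := fun A B hA hB => by
        rw [Finset.subset_empty.1 hA, Finset.subset_empty.1 hB, Finset.empty_union, h0, add_zero] }
  exact ⟨z⟩

variable {M N : Type u} {δM : Finset M → ℝ} {δN : Finset N → ℝ}

theorem PartialIso.pair_eq [DecidableEq M] [DecidableEq N] {P : Set (M × N)}
    (h : PartialIso δM δN P) {p q : M × N} (hp : p ∈ P) (hq : q ∈ P) :
    δM {p.1, q.1} = δN {p.2, q.2} := by
  have := h.image_eq Finset.univ (fun b : Bool => if b then p else q)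
    (by rintro (_ | _) _ <;> simpa)
  simpa using this

/-- As M is a diversity, the second coordinate of a pair in P determines the first. Along this
inverse map the extension by x becomes a one-point extension of a finite subset of N, and y realises
it. -/
theorem PartialIso.exists_insert [DecidableEq M] [DecidableEq N] (hM : IsDiversity δM)
    (hN : ExactExt δN) {P : Finset (M × N)} (h : PartialIso δM δN P) (x : M) :
    ∃ y, PartialIso δM δN (insert (x, y) (P : Set (M × N))) := by
  classical
  have hg : ∀ n, ∃ m, n ∈ P.image Prod.snd → (m, n) ∈ P := by
    intro n
    by_cases hn : n ∈ P.image Prod.snd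
    · obtain ⟨⟨m, n'⟩, hp, rfl⟩ := Finset.mem_image.1 hn
      exact ⟨m, fun _ => hp⟩
    · exact ⟨x, fun h => absurd h hn⟩
  choose g hg using hg
  have hgP : ∀ p ∈ P, g p.2 = p.1 := by
    intro p hp
    have hp' := hg p.2 (Finset.mem_image_of_mem _ hp)
    refine hM.eq_of_pair ?_
    have h1 := h.pair_eq (p := (g p.2, p.2)) (q := p) hp' hp
    have h2 := h.pair_eq (p := p) (q := p) hp hp
    rw [h1, ← h2, Finset.pair_eq_singleton, hM.singleton]
  have hk := (hM.katOn_comap g x (P.image Prod.snd)).congr (δ' := δN) (fun A hA => by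
    have := h.image_eq A (fun n => (g n, n)) (fun n hn => hg n (hA hn))
    simpa using this) (fun _ _ => rfl)
  obtain ⟨y, hy⟩ := hN _ _ hk
  refine ⟨y, fun Q hQ => ?_⟩
  have key : ∀ Q : Finset (M × N), Q ⊆ P →
      δM (insert x (Q.image Prod.fst)) = δN (insert y (Q.image Prod.snd)) := by
    intro Q hQ
    rw [hy _ (Finset.image_subset_image hQ), Finset.image_image]
    congr 2
    exact Finset.image_congr fun p hp => (hgP p (hQ hp)).symm
  by_cases hxy : (x, y) ∈ Q
  · have h1 := key (Q.erase (x, y)) (by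
      intro p hp
      rw [Finset.mem_erase] at hp
      exact (hQ hp.2).resolve_left hp.1)
    have h2 : insert (x, y) (Q.erase (x, y)) = Q := Finset.insert_erase hxy
    rw [← h2]
    convert h1 using 2 <;> (ext; simp)
  · refine h Q fun p hp => (hQ hp).resolve_left ?_
    rintro rfl
    exact hxy hp

/-- The sets `T n` are tasks met one by one. The union of the chain is a partial isomorphism because
a finite part of it already lies in one stage. -/
theorem PartialIso.exists_union {P₀ : Finset (M × N)} (h₀ : PartialIso δM δN P₀)
    (T : ℕ → Set (M × N))
    (hT : ∀ n (P : Finset (M × N)), PartialIso δM δN P →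
      ∃ p ∈ T n, PartialIso δM δN (insert p (P : Set (M × N)))) :
    ∃ P : Set (M × N), PartialIso δM δN P ∧ (P₀ : Set (M × N)) ⊆ P ∧ ∀ n, ∃ p ∈ T n, p ∈ P := by
  classical
  obtain ⟨u, hu⟩ := exists_seq_of_step
    (fun (_ : ℕ) (P : Finset (M × N)) => PartialIso δM δN P ∧ P₀ ⊆ P)
    (fun n P P' => P ⊆ P' ∧ ∃ p ∈ T n, p ∈ P') ⟨P₀, h₀, subset_rfl⟩
    (by
      rintro n P ⟨h1, h2⟩
      obtain ⟨p, hp, h3⟩ := hT n P h1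
      have h4 := Finset.subset_insert p P
      exact ⟨insert p P, ⟨by rwa [Finset.coe_insert], h2.trans h4⟩, h4, p, hp, by simp⟩)
  have hmono : Monotone fun n => (u n : Set (M × N)) :=
    monotone_nat_of_le_succ fun n => Finset.coe_subset.2 (hu n).2.1
  refine ⟨⋃ n, (u n : Set (M × N)), fun Q hQ => ?_, ?_, fun n => ?_⟩
  · obtain ⟨n, hn⟩ := hmono.directed_le.exists_mem_subset_of_finset_subset_biUnion hQ
    exact (hu n).1.1 Q hn
  · exact (Finset.coe_subset.2 (hu 0).1.2).trans (Set.subset_iUnion (fun n => (u n : Set (M × N))) 0)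
  · obtain ⟨p, hp, h1⟩ := (hu n).2.2
    exact ⟨p, hp, Set.mem_iUnion.2 ⟨n + 1, h1⟩⟩

variable [MetricSpace M] [MetricSpace N]

/-- Replacing each pair of `Q` by a pair of `P` within ε changes both sides by at most `Q.card * ε`.
-/
theorem PartialIso.closure [DecidableEq M] [DecidableEq N] (hM : IsSemidiversity δM)
    (hN : IsSemidiversity δN) (hdM : ∀ x y, dist x y = δM {x, y})
    (hdN : ∀ x y, dist x y = δN {x, y}) {P : Set (M × N)} (h : PartialIso δM δN P) :
    PartialIso δM δN (closure P) := by
  classical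
  intro Q hQ
  have key : ∀ ε > 0, |δM (Q.image Prod.fst) - δN (Q.image Prod.snd)| ≤ 2 * Q.card * ε := by
    intro ε hε
    have hb : ∀ q, ∃ p, q ∈ Q → p ∈ P ∧ dist q p < ε := by
      intro q
      by_cases hq : q ∈ Q
      · obtain ⟨p, hp⟩ := Metric.mem_closure_iff.1 (hQ hq) ε hε
        exact ⟨p, fun _ => hp⟩
      · exact ⟨q, fun h => absurd h hq⟩
    choose b hb using hb
    have h1 := hM.abs_image_sub_le Q Prod.fst fun q => (b q).1
    have h2 := hN.abs_image_sub_le Q Prod.snd fun q => (b q).2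
    have h3 := h.image_eq Q b fun q hq => (hb q hq).1
    have h4 : ∑ q ∈ Q, δM {q.1, (b q).1} ≤ Q.card • ε :=
      Finset.sum_le_card_nsmul _ _ _ fun q hq => by
        rw [← hdM]
        exact ((le_max_left _ _).trans_lt (hb q hq).2).le
    have h5 : ∑ q ∈ Q, δN {q.2, (b q).2} ≤ Q.card • ε :=
      Finset.sum_le_card_nsmul _ _ _ fun q hq => by
        rw [← hdN]
        exact ((le_max_right _ _).trans_lt (hb q hq).2).le
    rw [nsmul_eq_mul] at h4 h5
    rw [abs_le] at *
    constructor <;> linarith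
  have h1 : |δM (Q.image Prod.fst) - δN (Q.image Prod.snd)| ≤ 0 := by
    refine le_of_forall_pos_le_add fun ε hε => ?_
    have h2 : (0 : ℝ) < 2 * Q.card + 1 := by positivity
    refine (key (ε / (2 * Q.card + 1)) (by positivity)).trans ?_
    rw [zero_add, ← mul_div_assoc, div_le_iff₀ h2]
    nlinarith
  have h2 := sub_eq_zero.1 (abs_nonpos_iff.1 h1)
  convert h2

/-- A partial isomorphism preserves distances, so when first coordinates converge to m the second
coordinates are Cauchy. -/
theorem PartialIso.exists_mem_closure [DecidableEq M] [DecidableEq N] [CompleteSpace N]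
    (hdM : ∀ x y, dist x y = δM {x, y})
    (hdN : ∀ x y, dist x y = δN {x, y}) {P : Set (M × N)} (h : PartialIso δM δN P)
    (hd : Dense (Prod.fst '' P)) (m : M) : ∃ n, (m, n) ∈ _root_.closure P := by
  have hp : ∀ k : ℕ, ∃ p ∈ P, dist m p.1 < 1 / ((k : ℝ) + 1) := by
    intro k
    obtain ⟨_, ⟨p, hp, rfl⟩, h1⟩ := Metric.mem_closure_iff.1 (hd m) (1 / ((k : ℝ) + 1))
      (by positivity)
    exact ⟨p, hp, h1⟩
  choose p hpP hp using hp
  have hpm : Tendsto (fun k => (p k).1) atTop (𝓝 m) := by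
    rw [tendsto_iff_dist_tendsto_zero]
    refine squeeze_zero (fun _ => dist_nonneg) (fun k => ?_)
      tendsto_one_div_add_atTop_nhds_zero_nat
    rw [dist_comm]
    exact (hp k).le
  have hc : CauchySeq fun k => (p k).2 := by
    have h1 := hpm.cauchySeq
    rw [Metric.cauchySeq_iff] at h1 ⊢
    intro ε hε
    obtain ⟨N, hN⟩ := h1 ε hε
    refine ⟨N, fun k hk l hl => ?_⟩
    rw [hdN, ← h.pair_eq (hpP k) (hpP l), ← hdM]
    exact hN k hk l hl
  obtain ⟨n, hn⟩ := cauchySeq_tendsto_of_complete hc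
  exact ⟨n, mem_closure_of_tendsto (hpm.prodMk_nhds hn) (Eventually.of_forall hpP)⟩

theorem PartialIso.exists_embedding [DecidableEq M] [DecidableEq N] [CompleteSpace N]
    [TopologicalSpace.SeparableSpace M] (hM : IsDiversity δM) (hN : IsSemidiversity δN)
    (hdM : ∀ x y, dist x y = δM {x, y}) (hdN : ∀ x y, dist x y = δN {x, y})
    (hext : ExactExt δN) {P₀ : Finset (M × N)} (h : PartialIso δM δN P₀) :
    ∃ f : M → N, (∀ S : Finset M, δN (S.image f) = δM S) ∧ ∀ p ∈ P₀, f p.1 = p.2 := by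
  rcases isEmpty_or_nonempty M with hM' | hM'
  · refine ⟨fun m => isEmptyElim m, fun S => ?_, fun p => isEmptyElim p.1⟩
    rw [Finset.eq_empty_of_isEmpty S]
    simp [hM.empty, hN.empty]
  obtain ⟨P, hP, hP₀, hT⟩ := h.exists_union
    (fun n => {p | p.1 = TopologicalSpace.denseSeq M n})
    (fun n P h => by
      obtain ⟨y, hy⟩ := h.exists_insert hM hext (TopologicalSpace.denseSeq M n)
      exact ⟨_, rfl, hy⟩)
  have hd : Dense (Prod.fst '' P) := by
    refine (TopologicalSpace.denseRange_denseSeq M).mono ?_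
    rintro _ ⟨n, rfl⟩
    obtain ⟨p, hp, h1⟩ := hT n
    exact ⟨p, h1, hp⟩
  choose f hf using hP.exists_mem_closure hdM hdN hd
  have hc := hP.closure hM.toIsSemidiversity hN hdM hdN
  refine ⟨f, fun S => ?_, fun p hp => ?_⟩
  · have := hc.image_eq S (fun m => (m, f m)) fun m _ => hf m
    simpa using this.symm
  · have h1 := hc.pair_eq (hf p.1) (subset_closure (hP₀ hp))
    rw [← hdM, ← hdN, dist_self] at h1
    exact dist_eq_zero.1 h1.symm

/-- The tasks, indexed by ℕ ⊕ ℕ, put dense sequences of both spaces into the two projections. The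
closure of the resulting relation is a graph, and `exists_mem_closure` for the swapped relation
gives surjectivity. -/
theorem PartialIso.exists_isometry [DecidableEq M] [DecidableEq N] [CompleteSpace M]
    [CompleteSpace N] [TopologicalSpace.SeparableSpace M] [TopologicalSpace.SeparableSpace N]
    (hM : IsDiversity δM) (hN : IsDiversity δN)
    (hdM : ∀ x y, dist x y = δM {x, y}) (hdN : ∀ x y, dist x y = δN {x, y})
    (hextM : ExactExt δM) (hextN : ExactExt δN) {P₀ : Finset (M × N)}
    (h : PartialIso δM δN P₀) :
    ∃ f : M → N, (∀ S : Finset M, δN (S.image f) = δM S) ∧ (∀ p ∈ P₀, f p.1 = p.2) ∧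
      Function.Surjective f := by
  have := hextM.nonempty hM.empty
  have := hextN.nonempty hN.empty
  let e := Equiv.natSumNatEquivNat
  obtain ⟨P, hP, hP₀, hT⟩ := h.exists_union
    (fun n => Sum.elim (fun k => {p | p.1 = TopologicalSpace.denseSeq M k})
      (fun k => {p | p.2 = TopologicalSpace.denseSeq N k}) (e.symm n))
    (fun n P h => by
      rcases e.symm n with k | k
      · obtain ⟨y, hy⟩ := h.exists_insert hM hextN (TopologicalSpace.denseSeq M k)
        exact ⟨_, rfl, hy⟩
      · have hs := h.swap
        rw [← Finset.coe_image] at hs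
        obtain ⟨x, hx⟩ := hs.exists_insert hN hextM (TopologicalSpace.denseSeq N k)
        refine ⟨(x, TopologicalSpace.denseSeq N k), rfl, hx.swap.mono ?_⟩
        rw [Set.image_insert_eq, Finset.coe_image, Set.image_image]
        simp)
  have hd : Dense (Prod.fst '' P) := by
    refine (TopologicalSpace.denseRange_denseSeq M).mono ?_
    rintro _ ⟨n, rfl⟩
    obtain ⟨p, hp, h1⟩ := hT (e (Sum.inl n))
    rw [e.symm_apply_apply] at hp
    exact ⟨p, h1, hp⟩
  have hd' : Dense (Prod.fst '' (Prod.swap '' P)) := by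
    refine (TopologicalSpace.denseRange_denseSeq N).mono ?_
    rintro _ ⟨n, rfl⟩
    obtain ⟨p, hp, h1⟩ := hT (e (Sum.inr n))
    rw [e.symm_apply_apply] at hp
    exact ⟨p.swap, ⟨p, h1, rfl⟩, hp⟩
  have hc := hP.closure hM.toIsSemidiversity hN.toIsSemidiversity hdM hdN
  choose f hf using hP.exists_mem_closure hdM hdN hd
  have huniq : ∀ {p}, p ∈ _root_.closure P → f p.1 = p.2 := by
    intro p hp
    have h1 := hc.pair_eq (hf p.1) hp
    rw [← hdM, ← hdN, dist_self] at h1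
    exact dist_eq_zero.1 h1.symm
  refine ⟨f, fun S => ?_, fun p hp => huniq (subset_closure (hP₀ hp)), fun n => ?_⟩
  · have := hc.image_eq S (fun m => (m, f m)) fun m _ => hf m
    simpa using this.symm
  · obtain ⟨m, hm⟩ := hP.swap.exists_mem_closure hdN hdM hd' n
    have h1 := map_mem_closure continuous_swap hm (t := P) (by
      rintro _ ⟨p, hp, rfl⟩
      simpa using hp)
    exact ⟨m, huniq h1⟩

end BackAndForth

/-! ## Diversities as metric structures -/

section Structures

open Classical in
/-- The metric structure `A` is the diversity `δ` on its carrier. -/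
structure Represents (A : MetricStr.{u} divLang) (δ : Finset A → ℝ) : Prop where
  div : IsDiversity δ
  dist_eq : ∀ x y : A, dist x y = δ {x, y}
  interp_eq : ∀ (R : divLang.Pred) (x : Fin (divLang.arity R) → A),
    A.interp R x = δ (Finset.univ.image x)

theorem isDiversityStr_iff {A : MetricStr.{u} divLang} :
    IsDiversityStr A ↔ ∃ δ, Represents A δ :=
  ⟨fun ⟨δ, h1, h2, h3⟩ => ⟨δ, h1, h2, h3⟩, fun ⟨δ, h⟩ => ⟨δ, h.div, h.dist_eq, h.interp_eq⟩⟩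

theorem Represents.isDiversityStr {A : MetricStr.{u} divLang} {δ : Finset A → ℝ}
    (h : Represents A δ) : IsDiversityStr A := isDiversityStr_iff.2 ⟨δ, h⟩

open Classical in
/-- The diversity represented by a metric structure. -/
noncomputable def divOf (A : MetricStr.{u} divLang) : Finset A → ℝ :=
  if h : IsDiversityStr A then (isDiversityStr_iff.1 h).choose else 0

theorem IsDiversityStr.represents {A : MetricStr.{u} divLang} (h : IsDiversityStr A) :
    Represents A (divOf A) := by
  rw [divOf, dif_pos h]
  exact (isDiversityStr_iff.1 h).choose_spec

variable {A B : MetricStr.{u} divLang} {δ : Finset A → ℝ} {ε : Finset B → ℝ}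

theorem Represents.dist_eq' [DecidableEq A] (h : Represents A δ) (x y : A) :
    dist x y = δ {x, y} := by
  convert h.dist_eq x y

theorem Represents.interp_eq' [DecidableEq A] (h : Represents A δ) (R : divLang.Pred)
    (x : Fin (divLang.arity R) → A) : A.interp R x = δ (Finset.univ.image x) := by
  convert h.interp_eq R x

/-- Thus the predicates determine the diversity on nonempty sets; the empty set has no predicate but
always has value 0. -/
theorem exists_image_eq {X : Type*} [DecidableEq X] {S : Finset X} (hS : S.Nonempty) :
    ∃ (R : divLang.Pred) (x : Fin (divLang.arity R) → X), Finset.univ.image x = S := by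
  refine ⟨⟨S.card, hS.card_pos⟩, fun i => (S.equivFin.symm i : X), ?_⟩
  ext y
  simp only [Finset.mem_image, Finset.mem_univ, true_and]
  constructor
  · rintro ⟨i, rfl⟩
    exact Subtype.prop _
  · intro hy
    exact ⟨S.equivFin ⟨y, hy⟩, by simp⟩

theorem Represents.image_emb [DecidableEq B] (hA : Represents A δ) (hB : Represents B ε)
    (f : MetricStr.Emb A B) (S : Finset A) : ε (S.image f.toFun) = δ S := by
  classical
  rcases S.eq_empty_or_nonempty with rfl | hS
  · simp [hA.div.empty, hB.div.empty]
  obtain ⟨R, x, rfl⟩ := exists_image_eq hS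
  rw [← hA.interp_eq' R x, ← f.map_pred, hB.interp_eq', Finset.image_image]
  rfl

/-- Maps that preserve the diversity are embeddings. -/
def Represents.emb [DecidableEq B] (hA : Represents A δ) (hB : Represents B ε) (f : A → B)
    (hf : ∀ S : Finset A, ε (S.image f) = δ S) : MetricStr.Emb A B where
  toFun := f
  map_dist x y := by
    classical
    rw [hA.dist_eq', hB.dist_eq', ← hf, Finset.image_insert, Finset.image_singleton]
  map_pred R x := by
    classical
    rw [hA.interp_eq', hB.interp_eq', ← hf, Finset.image_image]
    rfl

theorem Represents.of_emb [DecidableEq B] (hB : Represents B ε) (f : MetricStr.Emb A B) :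
    Represents A fun S => ε (S.image f.toFun) := by
  classical
  refine ⟨.of_pair (hB.div.comap f.toFun) fun x y hxy => ?_, fun x y => ?_, fun R x => ?_⟩
  · rw [Finset.image_insert, Finset.image_singleton, ← hB.dist_eq', f.map_dist] at hxy
    exact dist_eq_zero.1 hxy
  · rw [Finset.image_insert, Finset.image_singleton, ← hB.dist_eq', f.map_dist]
  · rw [← f.map_pred, hB.interp_eq', Finset.image_image]
    rfl

theorem IsDiversityStr.isKStructure (h : IsDiversityStr A) :
    IsKStructure finDiversities.{u} A := by
  classical
  rintro B hB ⟨f⟩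
  exact ⟨hB, (h.represents.of_emb f).isDiversityStr⟩

theorem Represents.isCopy_iff [DecidableEq A] [DecidableEq B] (hA : Represents A δ)
    (hB : Represents B ε) {n : ℕ} {a : Fin n → A} {b : Fin n → B} :
    MetricStr.IsCopy a b ↔ ∀ S : Finset (Fin n), ε (S.image b) = δ (S.image a) := by
  constructor
  · intro h S
    rcases S.eq_empty_or_nonempty with rfl | hS
    · simp [hA.div.empty, hB.div.empty]
    obtain ⟨R, x, rfl⟩ := exists_image_eq hS
    have := h.2 R x
    rw [hA.interp_eq', hB.interp_eq'] at this
    rw [Finset.image_image, Finset.image_image]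
    exact this
  · refine fun h => ⟨fun i j => ?_, fun R s => ?_⟩
    · have := h {i, j}
      simp only [Finset.image_insert, Finset.image_singleton] at this
      rw [hA.dist_eq', hB.dist_eq', this]
    · have := h (Finset.univ.image s)
      rw [Finset.image_image, Finset.image_image] at this
      rw [hA.interp_eq', hB.interp_eq']
      exact this

theorem MetricStr.IsCopy.symm {L : RelLang} {A B : MetricStr.{u} L} {n : ℕ} {a : Fin n → A}
    {b : Fin n → B} (h : MetricStr.IsCopy a b) : MetricStr.IsCopy b a :=
  ⟨fun i j => (h.1 i j).symm, fun R s => (h.2 R s).symm⟩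

theorem MetricStr.IsCopy.trans {L : RelLang} {A B C : MetricStr.{u} L} {n : ℕ} {a : Fin n → A}
    {b : Fin n → B} {c : Fin n → C} (h : MetricStr.IsCopy a b) (h' : MetricStr.IsCopy b c) :
    MetricStr.IsCopy a c :=
  ⟨fun i j => (h'.1 i j).trans (h.1 i j), fun R s => (h'.2 R s).trans (h.2 R s)⟩

theorem MetricStr.Emb.isCopy {L : RelLang} {A B : MetricStr.{u} L} (f : MetricStr.Emb A B) {n : ℕ}
    (a : Fin n → A) : MetricStr.IsCopy a fun i => f.toFun (a i) :=
  ⟨fun _ _ => f.map_dist _ _, fun R _ => f.map_pred R _⟩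

/-- Composition of embeddings. -/
def MetricStr.Emb.comp {L : RelLang} {A B C : MetricStr.{u} L} (g : MetricStr.Emb B C)
    (f : MetricStr.Emb A B) : MetricStr.Emb A C where
  toFun x := g.toFun (f.toFun x)
  map_dist _ _ := (g.map_dist _ _).trans (f.map_dist _ _)
  map_pred R x := (g.map_pred R _).trans (f.map_pred R x)

/-! ### Finite substructures -/

/-- The substructure on a finite subset. -/
def MetricStr.finSub {L : RelLang} (A : MetricStr.{u} L) (s : Set A) [Finite s] :
    MetricStr.{u} L where
  carrier := s
  interp R x := A.interp R fun i => (x i : A)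
  unifCont R := (A.unifCont R).comp (uniformContinuous_pi.2 fun i =>
    uniformContinuous_subtype_val.comp (Pi.uniformContinuous_proj _ i))

noncomputable instance {L : RelLang} (A : MetricStr.{u} L) (s : Set A) [Finite s] :
    Fintype (A.finSub s) :=
  Fintype.ofFinite s

/-- The inclusion of a finite substructure. -/
def MetricStr.finSubEmb {L : RelLang} (A : MetricStr.{u} L) (s : Set A) [Finite s] :
    MetricStr.Emb (A.finSub s) A where
  toFun x := x.1
  map_dist _ _ := rfl
  map_pred _ _ := rfl

/-- Restriction of the codomain of an embedding to a finite substructure. -/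
def MetricStr.Emb.codRestrict {L : RelLang} {A B : MetricStr.{u} L} (f : MetricStr.Emb A B)
    (s : Set B) [Finite s] (hs : ∀ x, f.toFun x ∈ s) : MetricStr.Emb A (B.finSub s) where
  toFun x := ⟨f.toFun x, hs x⟩
  map_dist x y := f.map_dist x y
  map_pred R x := f.map_pred R x

theorem IsKStructure.finSub_mem {L : RelLang} {K : Set (MetricStr.{u} L)} {A : MetricStr.{u} L}
    (h : IsKStructure K A) (s : Set A) [hs : Finite s] : A.finSub s ∈ K :=
  h _ hs ⟨A.finSubEmb s⟩

/-- The value on S is read off in the substructure on S. Inclusions of finite substructures preserve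
diversities, so every larger one gives the same value, and each axiom concerns finitely many points.
-/
theorem IsKStructure.isDiversityStr (h : IsKStructure finDiversities.{u} A) :
    IsDiversityStr A := by
  classical
  have hrep : ∀ s : Finset A, Represents (A.finSub s) (divOf (A.finSub s)) := fun s =>
    (h.finSub_mem s).2.represents
  let δ : Finset A → ℝ := fun S => divOf (A.finSub S) Finset.univ
  have key : ∀ (s : Finset A) (T : Finset (A.finSub s)),
      δ (T.image (A.finSubEmb s).toFun) = divOf (A.finSub s) T := by
    intro s T
    have hT : ∀ x, (A.finSubEmb (T.image (A.finSubEmb s).toFun)).toFun x ∈ s := by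
      rintro ⟨x, hx⟩
      rw [Finset.mem_coe, Finset.mem_image] at hx
      obtain ⟨y, _, rfl⟩ := hx
      exact y.2
    let f := (A.finSubEmb (T.image (A.finSubEmb s).toFun)).codRestrict s hT
    refine (Represents.image_emb (hrep _) (hrep s) f Finset.univ).symm.trans ?_
    congr 1
    ext y
    refine Finset.mem_image.trans ⟨?_, ?_⟩
    · rintro ⟨⟨x, hx⟩, _, h1⟩
      rw [Finset.mem_coe, Finset.mem_image] at hx
      obtain ⟨z, hz, rfl⟩ := hx
      rw [← h1]
      exact hz
    · intro hyT
      exact ⟨⟨y.1, Finset.mem_coe.2 (Finset.mem_image.2 ⟨_, hyT, rfl⟩)⟩, Finset.mem_univ _, rfl⟩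
  have hlift : ∀ (s S : Finset A), S ⊆ s →
      ∃ T : Finset (A.finSub s), T.image (A.finSubEmb s).toFun = S := by
    intro s S hS
    refine ⟨Finset.univ.filter fun x : A.finSub s => (A.finSubEmb s).toFun x ∈ S, ?_⟩
    ext x
    simp only [Finset.mem_image, Finset.mem_filter, Finset.mem_univ, true_and]
    constructor
    · rintro ⟨y, hy, rfl⟩
      exact hy
    · exact fun hx => ⟨⟨x, hS hx⟩, hx, rfl⟩
  have hinterp : ∀ (R : divLang.Pred) (x : Fin (divLang.arity R) → A),
      A.interp R x = δ (Finset.univ.image x) := by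
    intro R x
    let s := Finset.univ.image x
    let y : Fin (divLang.arity R) → A.finSub s := fun i =>
      ⟨x i, Finset.mem_coe.2 (Finset.mem_image_of_mem _ (Finset.mem_univ i))⟩
    have h1 : A.interp R x = (A.finSub s).interp R y := rfl
    rw [h1, (hrep s).interp_eq', ← key, Finset.image_image]
    rfl
  have hdist : ∀ x y : A, dist x y = δ {x, y} := by
    intro x y
    let s : Finset A := {x, y}
    let x' : A.finSub s := ⟨x, by simp [s]⟩
    let y' : A.finSub s := ⟨y, by simp [s]⟩
    have h1 : dist x y = dist x' y' := rfl
    rw [h1, (hrep s).dist_eq', ← key, Finset.image_insert, Finset.image_singleton]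
    rfl
  refine Represents.isDiversityStr (δ := δ) ⟨.of_pair (.of_glue ?_ ?_ ?_ ?_) ?_, ?_, ?_⟩
  · have := key ∅ ∅
    rwa [Finset.image_empty, (hrep ∅).div.empty] at this
  · intro x
    have := hdist x x
    rw [dist_self, Finset.pair_eq_singleton] at this
    exact this.symm
  · intro S T hST
    obtain ⟨S', rfl⟩ := hlift T S hST
    obtain ⟨T', hT'⟩ := hlift T T subset_rfl
    have h1 : S' ⊆ T' := by
      intro x hx
      obtain ⟨z, hz, h2⟩ := Finset.mem_image.1
        ((Finset.ext_iff.1 hT' _).2 (hST (Finset.mem_image_of_mem _ hx)))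
      rwa [← Subtype.ext h2]
    have h2 := key T T'
    rw [hT'] at h2
    rw [key, h2]
    exact (hrep T).div.mono h1
  · intro S T hST
    obtain ⟨S', hS⟩ := hlift (S ∪ T) S Finset.subset_union_left
    obtain ⟨T', hT⟩ := hlift (S ∪ T) T Finset.subset_union_right
    have h1 := key (S ∪ T) S'
    have h2 := key (S ∪ T) T'
    have h3 := key (S ∪ T) (S' ∪ T')
    rw [Finset.image_union, hS, hT] at h3
    rw [hS] at h1
    rw [hT] at h2
    rw [h1, h2, h3]
    refine (hrep (S ∪ T)).div.glue ?_
    obtain ⟨x, hx⟩ := hST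
    rw [Finset.mem_inter] at hx
    obtain ⟨y, hy, h4⟩ := Finset.mem_image.1 (hS.symm ▸ hx.1)
    obtain ⟨z, hz, h5⟩ := Finset.mem_image.1 (hT.symm ▸ hx.2)
    have h6 : y = z := Subtype.ext (h4.trans h5.symm)
    exact ⟨y, Finset.mem_inter.2 ⟨hy, h6 ▸ hz⟩⟩
  · intro x y hxy
    rw [← hdist] at hxy
    exact dist_eq_zero.1 hxy
  · intro x y
    convert hdist x y
  · intro R x
    convert hinterp R x

/-! ### Realising semidiversities -/

open Classical in
/-- A complete diversity as a metric structure. -/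
noncomputable def diversityStr {M : Type u} [MetricSpace M] [CompleteSpace M] (δ : Finset M → ℝ)
    (hδ : IsSemidiversity δ) (hdist : ∀ x y, dist x y = δ {x, y}) : MetricStr.{u} divLang where
  carrier := M
  interp _ x := δ (Finset.univ.image x)
  unifCont R := by
    rw [Metric.uniformContinuous_iff]
    intro r hr
    refine ⟨r / (divLang.arity R + 1), by positivity, fun {x y} hxy => ?_⟩
    rw [Real.dist_eq]
    refine (hδ.abs_image_sub_le Finset.univ x y).trans_lt ?_
    have h1 : ∑ i, δ {x i, y i} ≤ Finset.card (Finset.univ : Finset (Fin (divLang.arity R))) •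
        dist x y := Finset.sum_le_card_nsmul _ _ _ fun i _ => by
      rw [← hdist]
      exact dist_le_pi_dist x y i
    rw [Finset.card_univ, Fintype.card_fin, nsmul_eq_mul] at h1
    rw [lt_div_iff₀ (by positivity)] at hxy
    have h2 : (0 : ℝ) ≤ dist x y := dist_nonneg
    nlinarith

open Classical in
theorem represents_diversityStr {M : Type u} [MetricSpace M] [CompleteSpace M] {δ : Finset M → ℝ}
    (hδ : IsSemidiversity δ) (hdist : ∀ x y, dist x y = δ {x, y}) :
    Represents (diversityStr δ hδ hdist) δ where
  div := .of_pair hδ fun x y hxy => dist_eq_zero.1 ((hdist x y).trans hxy)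
  dist_eq := hdist
  interp_eq _ _ := rfl

/-- Every finite semidiversity is the diversity of an enumerated member of the class of finite
diversities. -/
theorem IsSemidiversity.exists_realization {X : Type} [Finite X] [DecidableEq X]
    {δ : Finset X → ℝ} (h : IsSemidiversity δ) :
    ∃ D ∈ finDiversities.{u}, ∃ (π : X → D) (δD : Finset D → ℝ), Represents D δD ∧
      ∀ (_ : DecidableEq D) (S : Finset X), δD (S.image π) = δ S := by
  classical
  have h0 : ∀ x y z, δ {x, y} = 0 → δ {y, z} = 0 → δ {x, z} = 0 := by
    intro x y z hxy hyz
    have h1 := h.glue (A := {x, y}) (B := {y, z}) ⟨y, by simp⟩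
    refine le_antisymm ?_ (h.nonneg _)
    refine (h.mono ?_).trans (h1.trans (by rw [hxy, hyz, add_zero]))
    intro w hw
    simp only [Finset.mem_insert, Finset.mem_singleton, Finset.mem_union] at hw ⊢
    tauto
  let s : Setoid X := ⟨fun x y => δ {x, y} = 0, fun x => by simp [h.singleton],
    fun {x y} hxy => by rwa [Finset.pair_comm], fun {x y z} => h0 x y z⟩
  let π : X → ULift.{u} (Quotient s) := fun x => ⟨Quotient.mk s x⟩
  let σ : ULift.{u} (Quotient s) → X := fun q => q.down.out
  have hσ : ∀ x, δ {σ (π x), x} = 0 := fun x => Quotient.mk_out (s := s) x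
  have hD : IsDiversity fun S : Finset (ULift.{u} (Quotient s)) => δ (S.image σ) := by
    refine .of_pair (h.comap σ) fun p q hpq => ?_
    rw [Finset.image_insert, Finset.image_singleton] at hpq
    have h1 : (Quotient.mk s p.down.out) = Quotient.mk s q.down.out := Quotient.sound hpq
    rw [Quotient.out_eq, Quotient.out_eq] at h1
    exact ULift.ext _ _ h1
  refine ⟨hD.toMetricStr, hD.toMetricStr_mem, π, _, ⟨hD, fun _ _ => rfl, fun _ _ => rfl⟩,
    fun inst S => ?_⟩
  -- Each point is at distance 0 from the chosen representative of its class, so replacing all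
  -- points of S by representatives leaves δ unchanged.
  have h1 := h.abs_image_sub_le S (σ ∘ π) id
  have h2 : ∑ x ∈ S, δ {(σ ∘ π) x, id x} = 0 := Finset.sum_eq_zero fun x _ => hσ x
  rw [h2, Finset.image_id] at h1
  rw [← sub_eq_zero.1 (abs_nonpos_iff.1 h1), ← Finset.image_image]
  exact congrArg (fun i : DecidableEq (ULift.{u} (Quotient s)) =>
    δ ((@Finset.image X _ i π S).image σ)) (Subsingleton.elim _ _)

end Structures

/-! ## Coupling two semidiversities on the same index set -/

section Coupling

variable {ι : Type*} [DecidableEq ι] {p q : Finset ι → ℝ}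

/-- `U` is the union of a finite family of sets that meet `B`, of total diversity `c`. -/
inductive StarCover (q : Finset ι → ℝ) (B : Finset ι) : Finset ι → ℝ → Prop
  | empty : StarCover q B ∅ 0
  | add {U R : Finset ι} {c : ℝ} : StarCover q B U c → (R ∩ B).Nonempty →
      StarCover q B (U ∪ R) (c + q R)

theorem StarCover.nonneg (hq : ∀ A, 0 ≤ q A) {B U : Finset ι} {c : ℝ} (h : StarCover q B U c) :
    0 ≤ c := by
  induction h with
  | empty => exact le_rfl
  | add _ _ ih => exact add_nonneg ih (hq _)

theorem StarCover.mono {B B' U : Finset ι} {c : ℝ} (h : StarCover q B U c) (hB : B ⊆ B') :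
    StarCover q B' U c := by
  induction h with
  | empty => exact .empty
  | add _ hR ih => exact .add ih (hR.mono (Finset.inter_subset_inter_left hB))

theorem StarCover.eq_of_empty {U : Finset ι} {c : ℝ} (h : StarCover q ∅ U c) :
    U = ∅ ∧ c = 0 := by
  cases h with
  | empty => exact ⟨rfl, rfl⟩
  | add _ hR => simp at hR

theorem StarCover.exists_split {B₁ B₂ U : Finset ι} {c : ℝ} (h : StarCover q (B₁ ∪ B₂) U c) :
    ∃ U₁ c₁ U₂ c₂, StarCover q B₁ U₁ c₁ ∧ StarCover q B₂ U₂ c₂ ∧ U = U₁ ∪ U₂ ∧ c = c₁ + c₂ := by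
  induction h with
  | empty => exact ⟨∅, 0, ∅, 0, .empty, .empty, by simp, by simp⟩
  | @add U R c _ hR ih =>
    obtain ⟨U₁, c₁, U₂, c₂, h1, h2, rfl, rfl⟩ := ih
    rw [Finset.inter_union_distrib_left, Finset.union_nonempty] at hR
    rcases hR with hR | hR
    · exact ⟨_, _, _, _, h1.add hR, h2, Finset.union_right_comm _ _ _, by ring⟩
    · exact ⟨_, _, _, _, h1, h2.add hR, Finset.union_assoc _ _ _, by ring⟩

/-- The pieces that meet B₂ are fused with B₂ into a single piece W. It meets B₁ because B₂ does,
and the extra cost is at most `q B₂`. -/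
theorem StarCover.exists_merge (hq : IsSemidiversity q) {B₁ B₂ U : Finset ι} {c : ℝ}
    (hB : (B₁ ∩ B₂).Nonempty) (h : StarCover q (B₁ ∪ B₂) U c) :
    ∃ U' c', StarCover q B₁ U' c' ∧ U ⊆ U' ∧ c' ≤ c + q B₂ := by
  have key : ∃ V W d, StarCover q B₁ V d ∧ B₂ ⊆ W ∧ U ⊆ V ∪ W ∧ d + q W ≤ c + q B₂ := by
    induction h with
    | empty => exact ⟨∅, B₂, 0, .empty, subset_rfl, by simp, le_rfl⟩
    | @add U R c _ hR ih =>
      obtain ⟨V, W, d, h1, h2, h3, h4⟩ := ih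
      rw [Finset.inter_union_distrib_left, Finset.union_nonempty] at hR
      rcases hR with hR | hR
      · refine ⟨_, W, _, h1.add hR, h2, ?_, by linarith⟩
        rw [Finset.union_right_comm]
        exact Finset.union_subset_union_left h3
      · refine ⟨V, W ∪ R, d, h1, h2.trans Finset.subset_union_left, ?_, ?_⟩
        · rw [← Finset.union_assoc]
          exact Finset.union_subset_union_left h3
        · have := hq.glue (A := W) (B := R) (by
            rw [Finset.inter_comm]
            exact hR.mono (Finset.inter_subset_inter_left h2))
          linarith
  obtain ⟨V, W, d, h1, h2, h3, h4⟩ := key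
  refine ⟨_, _, h1.add (R := W) ?_, h3, h4⟩
  rw [Finset.inter_comm]
  exact hB.mono (Finset.inter_subset_inter_left h2)

theorem StarCover.insert_le (hq : IsSemidiversity q) {i : ι} {U : Finset ι} {c : ℝ}
    (h : StarCover q {i} U c) : q (insert i U) ≤ c := by
  induction h with
  | empty => simp [hq.singleton]
  | @add U R c _ hR ih =>
    obtain ⟨j, hj⟩ := hR
    rw [Finset.mem_inter, Finset.mem_singleton] at hj
    have := hq.glue (A := insert i U) (B := R)
      ⟨i, Finset.mem_inter.2 ⟨Finset.mem_insert_self _ _, hj.2 ▸ hj.1⟩⟩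
    rw [Finset.insert_union] at this
    linarith

/-- The supremum of `p (A ∪ U) - c` over all star covers is finite, since costs are nonnegative and
`p` is at most `p Finset.univ`. -/
theorem exists_starSup [Finite ι] (hp : IsSemidiversity p) (hq : IsSemidiversity q) :
    ∃ φ : Finset ι → Finset ι → ℝ,
      (∀ A B U c, StarCover q B U c → p (A ∪ U) ≤ φ A B + c) ∧
      ∀ A B t, (∀ U c, StarCover q B U c → p (A ∪ U) ≤ t + c) → φ A B ≤ t := by
  have := Fintype.ofFinite ι
  refine ⟨fun A B => sSup {t | ∃ U c, StarCover q B U c ∧ t = p (A ∪ U) - c}, ?_, ?_⟩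
  · intro A B U c h
    rw [← sub_le_iff_le_add]
    refine le_csSup ⟨p Finset.univ, ?_⟩ ⟨U, c, h, rfl⟩
    rintro _ ⟨V, d, h', rfl⟩
    linarith [hp.mono (Finset.subset_univ (A ∪ V)), h'.nonneg hq.nonneg]
  · intro A B t h
    refine csSup_le ⟨_, ∅, 0, .empty, rfl⟩ ?_
    rintro _ ⟨V, d, h', rfl⟩
    linarith [h V d h']

/-- The part of the diversity of `A` (on the first copy of the index set) together with `B` (on
the second copy) that is forced by the diversity `p` on the first copy. -/
structure IsOneSided (p q : Finset ι → ℝ) (G : Finset ι → Finset ι → ℝ) : Prop where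
  of_empty : ∀ B, G ∅ B = 0
  le : ∀ A B U c, A.Nonempty → StarCover q B U c → p (A ∪ U) ≤ G A B + c
  min : ∀ A B t, A.Nonempty → (∀ U c, StarCover q B U c → p (A ∪ U) ≤ t + c) → G A B ≤ t

theorem exists_isOneSided [Finite ι] (hp : IsSemidiversity p) (hq : IsSemidiversity q) :
    ∃ G, IsOneSided p q G := by
  obtain ⟨φ, h1, h2⟩ := exists_starSup hp hq
  refine ⟨fun A B => if A.Nonempty then φ A B else 0, by simp, ?_, ?_⟩
  · intro A B U c hA h
    rw [if_pos hA]
    exact h1 A B U c h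
  · intro A B t hA h
    rw [if_pos hA]
    exact h2 A B t h

namespace IsOneSided

variable {G H : Finset ι → Finset ι → ℝ}

theorem right_empty (h : IsOneSided p q G) (hp : IsSemidiversity p) (A : Finset ι) :
    G A ∅ = p A := by
  rcases A.eq_empty_or_nonempty with rfl | hA
  · rw [h.of_empty, hp.empty]
  refine le_antisymm (h.min _ _ _ hA fun U c hU => ?_) ?_
  · obtain ⟨rfl, rfl⟩ := hU.eq_of_empty
    simp
  · simpa using h.le A ∅ ∅ 0 hA .empty

theorem mono (h : IsOneSided p q G) (hp : IsSemidiversity p) {A A' B B' : Finset ι}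
    (hA : A ⊆ A') (hB : B ⊆ B') : G A B ≤ G A' B' := by
  rcases A.eq_empty_or_nonempty with rfl | hne
  · rw [h.of_empty]
    rcases A'.eq_empty_or_nonempty with rfl | hne'
    · rw [h.of_empty]
    · have := h.le A' B' ∅ 0 hne' .empty
      linarith [hp.nonneg (A' ∪ ∅)]
  · refine h.min _ _ _ hne fun U c hU => ?_
    exact (hp.mono (Finset.union_subset_union_left hA)).trans
      (h.le _ _ _ _ (hne.mono hA) (hU.mono hB))

theorem nonneg (h : IsOneSided p q G) (hp : IsSemidiversity p) (A B : Finset ι) : 0 ≤ G A B :=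
  h.of_empty B ▸ h.mono hp (Finset.empty_subset A) (subset_refl B)

/-- A star cover of `{i}` costs at least `q (insert i U)`, so p and q are compared on just one set
and the error r is paid once. -/
theorem singleton_le (h : IsOneSided p q G) (hq : IsSemidiversity q)
    {r : ℝ} (hr : ∀ S, p S ≤ q S + r) (i : ι) : G {i} {i} ≤ r := by
  refine h.min _ _ _ (by simp) fun U c hU => ?_
  rw [← Finset.insert_eq]
  linarith [hr (insert i U), hU.insert_le hq]

theorem sub_of_right (h : IsOneSided p q G) (h' : IsOneSided q p H) (hp : IsSemidiversity p)
    (hq : IsSemidiversity q) {A₁ B₁ B₂ : Finset ι} (hB : (B₁ ∩ B₂).Nonempty) :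
    G A₁ (B₁ ∪ B₂) ≤ G A₁ B₁ + H B₂ ∅ := by
  rcases A₁.eq_empty_or_nonempty with rfl | hne
  · rw [h.of_empty, h.of_empty, zero_add]
    exact h'.nonneg hq _ _
  rw [h'.right_empty hq]
  refine h.min _ _ _ hne fun U c hU => ?_
  obtain ⟨U', c', h1, h2, h3⟩ := hU.exists_merge hq hB
  linarith [hp.mono (Finset.union_subset_union_right (s := A₁) h2), h.le _ _ _ _ hne h1]

/-- If one of A₁, A₂ is empty, its partner B is absorbed by merging covers at cost q of that set,
which is the `H` term. Otherwise a cover of B₁ ∪ B₂ is split in two and the resulting sets are glued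
for `p`. -/
theorem sub (h : IsOneSided p q G) (h' : IsOneSided q p H) (hp : IsSemidiversity p)
    (hq : IsSemidiversity q) {A₁ A₂ B₁ B₂ : Finset ι}
    (hAB : (A₁ ∩ A₂).Nonempty ∨ (B₁ ∩ B₂).Nonempty) :
    G (A₁ ∪ A₂) (B₁ ∪ B₂) ≤ max (G A₁ B₁) (H B₁ A₁) + max (G A₂ B₂) (H B₂ A₂) := by
  rcases A₂.eq_empty_or_nonempty with rfl | h2
  · rw [Finset.union_empty]
    exact (h.sub_of_right h' hp hq (hAB.resolve_left (by simp))).trans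
      (add_le_add (le_max_left _ _) (le_max_right _ _))
  rcases A₁.eq_empty_or_nonempty with rfl | h1
  · rw [Finset.empty_union, Finset.union_comm, add_comm]
    refine (h.sub_of_right h' hp hq ?_).trans (add_le_add (le_max_left _ _) (le_max_right _ _))
    rw [Finset.inter_comm]
    exact hAB.resolve_left (by simp)
  refine le_trans ?_ (add_le_add (le_max_left _ _) (le_max_left _ _))
  refine h.min _ _ _ (h1.mono Finset.subset_union_left) fun U c hU => ?_
  obtain ⟨U₁, c₁, U₂, c₂, k1, k2, rfl, rfl⟩ := hU.exists_split
  rcases hAB with hA | hB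
  · have k3 := hp.glue (A := A₁ ∪ U₁) (B := A₂ ∪ U₂)
      (hA.mono (Finset.inter_subset_inter Finset.subset_union_left Finset.subset_union_left))
    rw [Finset.union_union_union_comm] at k3
    linarith [h.le A₁ B₁ _ _ h1 k1, h.le A₂ B₂ _ _ h2 k2]
  · obtain ⟨b, hb⟩ := hB
    rw [Finset.mem_inter] at hb
    -- Singletons cost nothing, so a common point b of B₁ and B₂ can be put into both covers; the
    -- two sets then meet.
    have k1' := k1.add (R := {b}) ⟨b, by simpa using hb.1⟩
    have k2' := k2.add (R := {b}) ⟨b, by simpa using hb.2⟩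
    rw [hq.singleton, add_zero] at k1' k2'
    have k3 := hp.glue (A := A₁ ∪ (U₁ ∪ {b})) (B := A₂ ∪ (U₂ ∪ {b})) ⟨b, by simp⟩
    have k4 : A₁ ∪ A₂ ∪ (U₁ ∪ U₂) ⊆ A₁ ∪ (U₁ ∪ {b}) ∪ (A₂ ∪ (U₂ ∪ {b})) := by
      intro x hx
      simp only [Finset.mem_union] at hx ⊢
      tauto
    linarith [hp.mono k4, h.le A₁ B₁ _ _ h1 k1', h.le A₂ B₂ _ _ h2 k2']

end IsOneSided

end Coupling

/-- Two semidiversities on the same finite set that differ by at most `r` have a common extension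
to two copies of that set, with corresponding points at distance at most `r`. -/
theorem IsSemidiversity.exists_coupling {ι : Type u} [Finite ι] [DecidableEq ι]
    {p q : Finset ι → ℝ} (hp : IsSemidiversity p) (hq : IsSemidiversity q) {r : ℝ}
    (hr : ∀ S, |p S - q S| ≤ r) :
    ∃ γ : Finset (ι ⊕ ι) → ℝ, IsSemidiversity γ ∧ (∀ S, γ (S.image Sum.inl) = p S) ∧
      (∀ S, γ (S.image Sum.inr) = q S) ∧ ∀ i, γ {Sum.inl i, Sum.inr i} ≤ r := by
  obtain ⟨G, hG⟩ := exists_isOneSided hp hq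
  obtain ⟨H, hH⟩ := exists_isOneSided hq hp
  -- Let A and B be the parts of S in the two copies. The demand is that mixed sets dominate p(A ∪
  -- B) and q(A ∪ B); gluing a star cover to B then forces at least `G A B`, and symmetrically `H B
  -- A`. The value 0 of `G` for empty A keeps the restriction to the second copy equal to q.
  let γ : Finset (ι ⊕ ι) → ℝ := fun S =>
    max (G S.toLeft S.toRight) (H S.toRight S.toLeft)
  have hl : ∀ S, γ (S.image Sum.inl) = p S := by
    intro S
    have h1 : (S.image (Sum.inl : ι → ι ⊕ ι)).toLeft = S := by ext; simp
    have h2 : (S.image (Sum.inl : ι → ι ⊕ ι)).toRight = ∅ := by ext; simp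
    simp only [γ, h1, h2, hG.right_empty hp, hH.of_empty, max_eq_left (hp.nonneg S)]
  have hri : ∀ S, γ (S.image Sum.inr) = q S := by
    intro S
    have h1 : (S.image (Sum.inr : ι → ι ⊕ ι)).toLeft = ∅ := by ext; simp
    have h2 : (S.image (Sum.inr : ι → ι ⊕ ι)).toRight = S := by ext; simp
    simp only [γ, h1, h2, hH.right_empty hq, hG.of_empty, max_eq_right (hq.nonneg S)]
  refine ⟨γ, .of_glue ?_ ?_ ?_ ?_, hl, hri, fun i => ?_⟩
  · simpa [hp.empty] using hl ∅
  · rintro (i | i)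
    · simpa [hp.singleton] using hl {i}
    · simpa [hq.singleton] using hri {i}
  · intro S T hST
    exact max_le_max
      (hG.mono hp (Finset.toLeft_subset_toLeft hST) (Finset.toRight_subset_toRight hST))
      (hH.mono hq (Finset.toRight_subset_toRight hST) (Finset.toLeft_subset_toLeft hST))
  · intro S T hST
    have h1 : (S ∪ T).toLeft = S.toLeft ∪ T.toLeft := by ext; simp
    have h2 : (S ∪ T).toRight = S.toRight ∪ T.toRight := by ext; simp
    have h3 : (S.toLeft ∩ T.toLeft).Nonempty ∨ (S.toRight ∩ T.toRight).Nonempty := by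
      obtain ⟨x | x, hx⟩ := hST
      · exact Or.inl ⟨x, by simpa using hx⟩
      · exact Or.inr ⟨x, by simpa using hx⟩
    simp only [γ, h1, h2]
    refine max_le (hG.sub hH hp hq h3) ?_
    rw [max_comm (G _ _), max_comm (G _ _)]
    exact hH.sub hG hq hp h3.symm
  · have h1 : ({Sum.inl i, Sum.inr i} : Finset (ι ⊕ ι)).toLeft = {i} := by ext; simp
    have h2 : ({Sum.inl i, Sum.inr i} : Finset (ι ⊕ ι)).toRight = {i} := by ext; simp
    simp only [γ, h1, h2]
    refine max_le (hG.singleton_le hq (fun S => ?_) i) (hH.singleton_le hp (fun S => ?_) i)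
    · linarith [abs_le.1 (hr S)]
    · linarith [abs_le.1 (hr S)]

/-! ## Consequences of the existence of an exact limit -/

section ExactLimit

theorem IsExactLimit.isApproxLimit {L : RelLang} {K : Set (MetricStr.{u} L)}
    {M : MetricStr.{u} L} (h : IsExactLimit K M) : IsApproxLimit K M where
  separable := h.separable
  isKStructure := h.isKStructure
  ext B hB n a t hat ε hε := by
    obtain ⟨f, hf⟩ := h.ext B hB n a t hat
    exact ⟨f, fun i => by rwa [hf, dist_self]⟩

/-- Universality embeds B somewhere in N; an automorphism then carries the image of the tuple to the
prescribed copy. -/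
theorem IsUniversalFor.isExactLimit {L : RelLang} {K : Set (MetricStr.{u} L)}
    {N : MetricStr.{u} L} (hu : IsUniversalFor K N) (hfin : ∀ A ∈ K, Finite A) (hp : HP K)
    (hK : IsKStructure K N) (hN : N.Ultrahomogeneous) : IsExactLimit K N where
  separable := hN.1
  isKStructure := hK
  ext B hB n a t hat := by
    have := hfin B hB
    obtain ⟨e⟩ := hu B inferInstance (hp B hB)
    have hc : ∀ x : Set.range fun i => e.toFun (a i), ∃ i, e.toFun (a i) = x := fun x => x.2
    choose c hc using hc
    have hea := e.isCopy a
    obtain ⟨g, hg⟩ := hN.2 (Set.range fun i => e.toFun (a i)) (fun x => t (c x))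
      (Set.finite_range _) (fun x y => by rw [hat.1, ← e.map_dist, hc, hc])
      (fun R x => by
        have h1 := hea.2 R fun k => c (x k)
        simp only [hc] at h1
        rw [h1]
        exact hat.2 R fun k => c (x k))
    refine ⟨g.toEmb.comp e, fun i => ?_⟩
    have h1 := hg ⟨e.toFun (a i), i, rfl⟩
    refine h1.trans (dist_eq_zero.1 ?_)
    rw [hat.1, ← e.map_dist, hc, dist_self]

theorem MetricStr.Emb.dist_comp {L : RelLang} {A B : MetricStr.{u} L} (f : MetricStr.Emb A B)
    {n : ℕ} (a b : Fin n → A) :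
    dist (fun i => f.toFun (a i)) (fun i => f.toFun (b i)) = dist a b := by
  refine le_antisymm ((dist_pi_le_iff dist_nonneg).2 fun i => ?_)
    ((dist_pi_le_iff dist_nonneg).2 fun i => ?_)
  · rw [f.map_dist]
    exact dist_le_pi_dist a b i
  · rw [← f.map_dist]
    exact dist_le_pi_dist (fun i => f.toFun (a i)) (fun i => f.toFun (b i)) i

/-- An enumerated structure given by a tuple of a `K`-structure. -/
def IsKStructure.enum {L : RelLang} {K : Set (MetricStr.{u} L)} {M : MetricStr.{u} L}
    (h : IsKStructure K M) {n : ℕ} (t : Fin n → M) : EnumStr K n where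
  str := M.finSub (Set.range t)
  mem := h.finSub_mem _
  tup i := ⟨t i, i, rfl⟩

theorem IsKStructure.enum_isCopy {L : RelLang} {K : Set (MetricStr.{u} L)} {M : MetricStr.{u} L}
    (h : IsKStructure K M) {n : ℕ} (t : Fin n → M) : MetricStr.IsCopy (h.enum t).tup t :=
  (M.finSubEmb (Set.range t)).isCopy (h.enum t).tup

variable {K : Set (MetricStr.{u} divLang)} {M : MetricStr.{u} divLang}

/-- This is the extension property for the empty tuple. All arities being positive, no predicate has
to be checked on it. -/
theorem IsExactLimit.exists_emb (h : IsExactLimit K M) {A : MetricStr.{u} divLang} (hA : A ∈ K) :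
    Nonempty (MetricStr.Emb A M) := by
  obtain ⟨f, _⟩ := h.ext A hA 0 Fin.elim0 Fin.elim0 ⟨fun i => i.elim0, fun R s =>
    (s ⟨0, R.2⟩).elim0⟩
  exact ⟨f⟩

theorem IsExactLimit.jep (h : IsExactLimit K M) (hfin : ∀ A ∈ K, Finite A) : JEP K := by
  intro A hA B hB
  have := hfin A hA
  have := hfin B hB
  obtain ⟨f⟩ := h.exists_emb hA
  obtain ⟨g⟩ := h.exists_emb hB
  exact ⟨M.finSub (Set.range f.toFun ∪ Set.range g.toFun), h.isKStructure.finSub_mem _,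
    ⟨f.codRestrict _ fun x => Or.inl ⟨x, rfl⟩⟩, ⟨g.codRestrict _ fun x => Or.inr ⟨x, rfl⟩⟩⟩

theorem IsExactLimit.ap (h : IsExactLimit K M) (hfin : ∀ A ∈ K, Finite A) : AP K := by
  intro A hA B hB C hC fB fC
  have := hfin A hA
  have := hfin B hB
  have := hfin C hC
  obtain ⟨f⟩ := h.exists_emb hB
  obtain ⟨n, ⟨e⟩⟩ := Finite.exists_equiv_fin A
  obtain ⟨g, hg⟩ := h.ext C hC n (fun i => fC.toFun (e.symm i))
    (fun i => f.toFun (fB.toFun (e.symm i)))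
    ((fC.isCopy e.symm).symm.trans ((f.comp fB).isCopy e.symm))
  refine ⟨M.finSub (Set.range f.toFun ∪ Set.range g.toFun), h.isKStructure.finSub_mem _,
    f.codRestrict _ fun x => Or.inl ⟨x, rfl⟩, g.codRestrict _ fun x => Or.inr ⟨x, rfl⟩,
    fun x => Subtype.ext ?_⟩
  have := hg (e x)
  rw [e.symm_apply_apply] at this
  exact this.symm

theorem IsExactLimit.exists_copy (h : IsExactLimit K M) {n : ℕ} (a : EnumStr K n) :
    ∃ t : Fin n → M, MetricStr.IsCopy a.tup t := by
  obtain ⟨f⟩ := h.exists_emb a.mem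
  exact ⟨_, f.isCopy a.tup⟩

theorem dK_bddBelow {n : ℕ} (a b : EnumStr K n) :
    BddBelow {r : ℝ | ∃ D ∈ K, ∃ a' b' : Fin n → D,
      MetricStr.IsCopy a.tup a' ∧ MetricStr.IsCopy b.tup b' ∧ r = dist a' b'} :=
  ⟨0, by rintro _ ⟨D, _, a', b', _, _, rfl⟩; exact dist_nonneg⟩

theorem IsKStructure.exists_mem_dist_eq (h : IsKStructure K M) {n : ℕ} {a b : EnumStr K n}
    {t s : Fin n → M} (ht : MetricStr.IsCopy a.tup t) (hs : MetricStr.IsCopy b.tup s) :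
    ∃ D ∈ K, ∃ a' b' : Fin n → D,
      MetricStr.IsCopy a.tup a' ∧ MetricStr.IsCopy b.tup b' ∧ dist t s = dist a' b' :=
  ⟨M.finSub (Set.range t ∪ Set.range s), h.finSub_mem _, fun i => ⟨t i, Or.inl ⟨i, rfl⟩⟩,
    fun i => ⟨s i, Or.inr ⟨i, rfl⟩⟩, ht, hs,
    (M.finSubEmb (Set.range t ∪ Set.range s)).dist_comp (fun i => ⟨t i, Or.inl ⟨i, rfl⟩⟩)
      fun i => ⟨s i, Or.inr ⟨i, rfl⟩⟩⟩

theorem IsKStructure.dK_le (h : IsKStructure K M) {n : ℕ} {a b : EnumStr K n}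
    {t s : Fin n → M} (ht : MetricStr.IsCopy a.tup t) (hs : MetricStr.IsCopy b.tup s) :
    dK a b ≤ dist t s :=
  csInf_le (dK_bddBelow a b) (h.exists_mem_dist_eq ht hs)

theorem IsExactLimit.dK_nonempty (h : IsExactLimit K M) {n : ℕ} (a b : EnumStr K n) :
    {r : ℝ | ∃ D ∈ K, ∃ a' b' : Fin n → D,
      MetricStr.IsCopy a.tup a' ∧ MetricStr.IsCopy b.tup b' ∧ r = dist a' b'}.Nonempty := by
  obtain ⟨t, ht⟩ := h.exists_copy a
  obtain ⟨s, hs⟩ := h.exists_copy b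
  exact ⟨_, h.isKStructure.exists_mem_dist_eq ht hs⟩

/-- The copy of `a` can be fixed in advance, because any joint embedding of `a` and `b` can be
carried into M with `a` landing on `t`. Copies can therefore be chained, as the triangle inequality
and completeness require. -/
theorem IsExactLimit.exists_copy_dist_lt (h : IsExactLimit K M) {n : ℕ} {a b : EnumStr K n}
    {t : Fin n → M} (ht : MetricStr.IsCopy a.tup t) {r : ℝ} (hr : dK a b < r) :
    ∃ s : Fin n → M, MetricStr.IsCopy b.tup s ∧ dist t s < r := by
  obtain ⟨_, ⟨D, hD, a', b', ha, hb, rfl⟩, hlt⟩ := exists_lt_of_csInf_lt (h.dK_nonempty a b) hr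
  obtain ⟨f, hf⟩ := h.ext D hD n a' t (ha.symm.trans ht)
  refine ⟨fun i => f.toFun (b' i), hb.trans (f.isCopy b'), ?_⟩
  have : t = fun i => f.toFun (a' i) := funext fun i => (hf i).symm
  rwa [this, f.dist_comp]

/-- The pseudometric `d_K` on enumerated structures. -/
noncomputable abbrev IsExactLimit.pseudoMetricSpace (h : IsExactLimit K M) (n : ℕ) :
    PseudoMetricSpace (EnumStr K n) where
  dist a b := dK a b
  dist_self a := by
    obtain ⟨t, ht⟩ := h.exists_copy a
    refine le_antisymm ((h.isKStructure.dK_le ht ht).trans (dist_self t).le) ?_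
    refine Real.sInf_nonneg ?_
    rintro _ ⟨D, _, a', b', _, _, rfl⟩
    exact dist_nonneg
  dist_comm a b := by
    unfold dK
    congr 1
    ext r
    constructor <;>
    · rintro ⟨D, hD, a', b', ha, hb, rfl⟩
      exact ⟨D, hD, b', a', hb, ha, dist_comm _ _⟩
  dist_triangle a b c := by
    refine le_of_forall_pos_le_add fun ε hε => ?_
    obtain ⟨t, ht⟩ := h.exists_copy a
    obtain ⟨s, hs, h1⟩ := h.exists_copy_dist_lt ht (lt_add_of_pos_right (dK a b) (half_pos hε))
    obtain ⟨w, hw, h2⟩ := h.exists_copy_dist_lt hs (lt_add_of_pos_right (dK b c) (half_pos hε))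
    linarith [h.isKStructure.dK_le ht hw, dist_triangle t s w]

/-- Separability comes from a countable dense set of tuples in M. A rapidly Cauchy sequence of
enumerated structures lifts to a Cauchy sequence of tuples in M, whose limit enumerates the required
structure. -/
theorem IsExactLimit.pp (h : IsExactLimit K M) : PP K := by
  intro n
  let P := h.pseudoMetricSpace n
  have hP : ∀ a b : EnumStr K n, dist a b = dK a b := fun _ _ => rfl
  refine ⟨P, fun _ _ => rfl, ?_, ?_⟩
  · have := h.separable
    obtain ⟨S, hS, hd⟩ := TopologicalSpace.exists_countable_dense (Fin n → M)
    refine ⟨h.isKStructure.enum '' S, hS.image _, fun a => ?_⟩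
    rw [Metric.mem_closure_iff]
    intro ε hε
    obtain ⟨t, ht⟩ := h.exists_copy a
    obtain ⟨s, hs, hts⟩ := Metric.mem_closure_iff.1 (hd t) ε hε
    refine ⟨_, Set.mem_image_of_mem _ hs, ?_⟩
    rw [hP]
    exact (h.isKStructure.dK_le ht (h.isKStructure.enum_isCopy s)).trans_lt hts
  · refine Metric.complete_of_convergent_controlled_sequences (fun N => (1 / 2 : ℝ) ^ N)
      (fun N => by positivity) fun v hv => ?_
    obtain ⟨t, ht⟩ := exists_seq_of_step (fun k (t : Fin n → M) => MetricStr.IsCopy (v k).tup t)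
      (fun k t s => dist t s ≤ 1 * (1 / 2 : ℝ) ^ k) (h.exists_copy (v 0))
      (fun k t ht => by
        obtain ⟨s, hs, hts⟩ := h.exists_copy_dist_lt ht (hv k k (k + 1) le_rfl k.le_succ)
        exact ⟨s, hs, by rw [one_mul]; exact hts.le⟩)
    obtain ⟨w, hw⟩ := cauchySeq_tendsto_of_complete
      (cauchySeq_of_le_geometric (1 / 2) 1 (by norm_num) fun k => (ht k).2)
    refine ⟨h.isKStructure.enum w, ?_⟩
    rw [tendsto_iff_dist_tendsto_zero] at hw ⊢
    refine squeeze_zero (fun _ => dist_nonneg) (fun k => ?_) hw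
    rw [hP]
    exact h.isKStructure.dK_le (ht k).1 (h.isKStructure.enum_isCopy w)

end ExactLimit

/-! ## The Urysohn diversity -/

section UrysohnDiversity

open Classical in
theorem exists_urysohn_diversity :
    ∃ (M : MetricStr.{u} divLang) (δ : Finset M → ℝ), TopologicalSpace.SeparableSpace M ∧
      Represents M δ ∧ ExactExt δ := by
  obtain ⟨δ, hδ, hext⟩ := exists_semidiversity_approxExt
  have hδ' := hδ.comap (ULift.down.{u} : ULift.{u} ℕ → ℕ)
  have hud : ∀ A : Finset (ULift.{u} ℕ), (A.image ULift.down).image ULift.up = A := fun A => by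
    rw [Finset.image_image]
    exact Finset.image_id
  have hdu : ∀ A : Finset ℕ, (A.image (ULift.up.{u})).image ULift.down = A := fun A => by
    rw [Finset.image_image]
    exact Finset.image_id
  have hext' : ApproxExt fun S : Finset (ULift.{u} ℕ) => δ (S.image ULift.down) := by
    intro F f hf ε hε
    rw [← hud F] at hf
    obtain ⟨z, hz⟩ := hext _ _ (hf.comap.congr (fun A _ => by rw [hdu]) (fun _ _ => rfl)) ε hε
    refine ⟨⟨z⟩, fun A hA => ?_⟩
    have := hz _ (Finset.image_subset_image (f := ULift.down) hA)
    rw [hud] at this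
    change |δ ((insert (ULift.up z) A).image ULift.down) - f A| ≤ ε
    rwa [Finset.image_insert]
  obtain ⟨M, _, _, hsep, δM, h1, h2, h3⟩ := exists_diversity_completion hδ' (by convert hext')
  exact ⟨diversityStr δM h1 h2, δM, hsep, represents_diversityStr h1 h2,
    h3.exactExt (M := M) h1 h2⟩

variable {M N : MetricStr.{u} divLang} {δM : Finset M → ℝ} {δN : Finset N → ℝ}

theorem Represents.partialIso (hM : Represents M δM) (hN : Represents N δN) {n : ℕ}
    {a : Fin n → M} {b : Fin n → N} (h : MetricStr.IsCopy a b) [DecidableEq (M × N)] :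
    PartialIso δM δN (Finset.univ.image fun i => (a i, b i) : Finset (M × N)) := by
  classical
  intro Q hQ
  rw [Finset.coe_subset, Finset.subset_image_iff] at hQ
  obtain ⟨S, _, rfl⟩ := hQ
  have := (hM.isCopy_iff hN).1 h S
  rw [Finset.image_image, Finset.image_image]
  exact this.symm

theorem partialIso_empty (hM : δM ∅ = 0) (hN : δN ∅ = 0) :
    PartialIso δM δN ((∅ : Finset (M × N)) : Set (M × N)) := by
  intro Q hQ
  rw [Finset.coe_subset, Finset.subset_empty] at hQ
  subst hQ
  simp [hM, hN]

theorem Represents.exists_emb_of_exactExt [DecidableEq M] [DecidableEq N] (hM : Represents M δM)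
    (hN : Represents N δN) (hsep : TopologicalSpace.SeparableSpace M) (hext : ExactExt δN)
    {P : Finset (M × N)} (hP : PartialIso δM δN P) :
    ∃ f : MetricStr.Emb M N, ∀ p ∈ P, f.toFun p.1 = p.2 := by
  obtain ⟨f, h1, h2⟩ := hP.exists_embedding hM.div hN.div.toIsSemidiversity hM.dist_eq'
    hN.dist_eq' hext
  exact ⟨hM.emb hN f h1, h2⟩

theorem Represents.exists_iso_of_exactExt [DecidableEq M] [DecidableEq N] (hM : Represents M δM)
    (hN : Represents N δN) (hsM : TopologicalSpace.SeparableSpace M)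
    (hsN : TopologicalSpace.SeparableSpace N) (heM : ExactExt δM) (heN : ExactExt δN)
    {P : Finset (M × N)} (hP : PartialIso δM δN P) :
    ∃ f : MetricStr.Iso M N, ∀ p ∈ P, f.toFun p.1 = p.2 := by
  obtain ⟨f, h1, h2, h3⟩ := hP.exists_isometry hM.div hN.div hM.dist_eq' hN.dist_eq' heM heN
  exact ⟨⟨hM.emb hN f h1, h3⟩, h2⟩

theorem Represents.isExactLimit [DecidableEq N] (hN : Represents N δN)
    (hsep : TopologicalSpace.SeparableSpace N) (hext : ExactExt δN) :
    IsExactLimit finDiversities.{u} N where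
  separable := hsep
  isKStructure := hN.isDiversityStr.isKStructure
  ext B hB n a t hat := by
    classical
    have := hB.1
    have hBr := hB.2.represents
    obtain ⟨f, hf⟩ := hBr.exists_emb_of_exactExt hN inferInstance hext (hBr.partialIso hN hat)
    exact ⟨f, fun i => hf (a i, t i) (Finset.mem_image_of_mem _ (Finset.mem_univ i))⟩

theorem Represents.isUniversalFor [DecidableEq N] (hN : Represents N δN) (hext : ExactExt δN) :
    IsUniversalFor finDiversities.{u} N := by
  classical
  intro A hA hK
  have hAr := hK.isDiversityStr.represents
  obtain ⟨f, _⟩ := hAr.exists_emb_of_exactExt hN hA hext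
    (partialIso_empty hAr.div.empty hN.div.empty)
  exact ⟨f⟩

theorem Represents.ultrahomogeneous [DecidableEq M] (hM : Represents M δM)
    (hsep : TopologicalSpace.SeparableSpace M) (hext : ExactExt δM) : M.Ultrahomogeneous := by
  classical
  refine ⟨hsep, fun S φ hS hd hp => ?_⟩
  have := hS.to_subtype
  obtain ⟨n, ⟨e⟩⟩ := Finite.exists_equiv_fin S
  have hc : MetricStr.IsCopy (fun i => (e.symm i : M)) fun i => φ (e.symm i) :=
    ⟨fun i j => hd _ _, fun R s => hp R fun k => e.symm (s k)⟩
  obtain ⟨g, hg⟩ := hM.exists_iso_of_exactExt hM hsep hsep hext hext (hM.partialIso hM hc)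
  refine ⟨g, fun x => ?_⟩
  have := hg (e.symm (e x), φ (e.symm (e x))) (Finset.mem_image_of_mem _ (Finset.mem_univ _))
  simpa using this

/-- A one-point extension of F is realised as an enumerated finite diversity and embedded in N with
F moved only slightly. So N realises it approximately, and completeness makes this exact. -/
theorem IsApproxLimit.exactExt [DecidableEq N] (h : IsApproxLimit finDiversities.{u} N)
    (hN : Represents N δN) : ExactExt δN := by
  classical
  refine ApproxExt.exactExt hN.div.toIsSemidiversity hN.dist_eq' fun F f hf ε hε => ?_
  let n := F.card
  let x : Fin n → N := fun i => F.equivFin.symm i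
  have hx : Finset.univ.image x = F := by
    ext y
    simp only [Finset.mem_image, Finset.mem_univ, true_and]
    constructor
    · rintro ⟨i, rfl⟩
      exact Subtype.prop _
    · exact fun hy => ⟨F.equivFin ⟨y, hy⟩, by simp [x]⟩
  have hxS : ∀ S : Finset (Fin n), S.image x ⊆ F := fun S => by
    rw [← hx]
    exact Finset.image_subset_image (Finset.subset_univ _)
  let ψ : Option (Fin n) → Option N := Option.map x
  have hψ : ∀ S : Finset (Fin n), (S.image some).image ψ = (S.image x).image some := fun S => by
    rw [Finset.image_image, Finset.image_image]
    rfl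
  obtain ⟨D, hD, π, δD, hDr, hπ⟩ :=
    ((hf.isSemidiversity_adjoin hN.div.toIsSemidiversity).comap ψ).exists_realization
  have hπ' := hπ inferInstance
  have h1 : MetricStr.IsCopy (fun i => π (some i)) x := by
    refine (hDr.isCopy_iff hN).2 fun S => ?_
    have h2 := hπ' (S.image some)
    rw [hψ, adjoin_of_subset (hxS S), Finset.image_image] at h2
    exact h2.symm
  -- At most n points move, for a total displacement of at most ε; the +1 covers empty F.
  obtain ⟨g, hg⟩ := h.ext D hD n _ x h1 (ε / (n + 1)) (by positivity)
  refine ⟨g.toFun (π none), fun A hA => ?_⟩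
  let S : Finset (Fin n) := Finset.univ.filter fun i => x i ∈ A
  have hS : S.image x = A := by
    ext y
    simp only [S, Finset.mem_image, Finset.mem_filter, Finset.mem_univ, true_and]
    constructor
    · rintro ⟨i, hi, rfl⟩
      exact hi
    · intro hy
      have := hA hy
      rw [← hx, Finset.mem_image] at this
      obtain ⟨i, _, rfl⟩ := this
      exact ⟨i, hy, rfl⟩
  have h2 : δN (insert (g.toFun (π none)) (S.image fun i => g.toFun (π (some i)))) = f A := by
    have h3 := hDr.image_emb hN g ((insert none (S.image some)).image π)
    rw [hπ', Finset.image_insert ψ, hψ, hS, adjoin_insert hA (by simp [ψ]), Finset.image_insert,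
      Finset.image_insert, Finset.image_image, Finset.image_image] at h3
    exact h3
  have h4 := (hN.div.katOn (g.toFun (π none)) (S.image x ∪ S.image fun i =>
    g.toFun (π (some i)))).toGlueOn.abs_image_sub_le S x (fun i => g.toFun (π (some i)))
    Finset.subset_union_left Finset.subset_union_right
  rw [h2, hS] at h4
  refine h4.trans ?_
  have h5 : ∑ i ∈ S, δN {x i, g.toFun (π (some i))} ≤ S.card • (ε / (n + 1)) :=
    Finset.sum_le_card_nsmul _ _ _ fun i _ => by
      rw [← hN.dist_eq', dist_comm]
      exact (hg i).le
  have h6 : (S.card : ℝ) ≤ n + 1 := by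
    have := S.card_le_univ
    rw [Fintype.card_fin] at this
    exact_mod_cast this.trans n.le_succ
  rw [nsmul_eq_mul] at h5
  refine h5.trans ?_
  calc (S.card : ℝ) * (ε / (n + 1)) ≤ (n + 1) * (ε / (n + 1)) := by gcongr
    _ = ε := by field_simp

end UrysohnDiversity

/-! ## Distances of enumerated finite diversities -/

section Distances

/-- The semidiversity on the index set given by an enumerated finite diversity. -/
noncomputable def EnumStr.div {n : ℕ} (a : EnumStr finDiversities.{u} n) (S : Finset (Fin n)) :
    ℝ := by
  classical exact divOf a.str (S.image a.tup)

variable {n : ℕ} (a b : EnumStr finDiversities.{u} n)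

theorem EnumStr.represents : Represents a.str (divOf a.str) := a.mem.2.represents

theorem EnumStr.div_eq [DecidableEq a.str] (S : Finset (Fin n)) :
    a.div S = divOf a.str (S.image a.tup) := by
  unfold EnumStr.div
  congr!

theorem EnumStr.isSemidiversity_div : IsSemidiversity a.div := by
  classical
  exact a.represents.div.comap a.tup

theorem EnumStr.isCopy_iff {D : MetricStr.{u} divLang} {δ : Finset D → ℝ} [DecidableEq D]
    (hD : Represents D δ) {t : Fin n → D} :
    MetricStr.IsCopy a.tup t ↔ ∀ S : Finset (Fin n), δ (S.image t) = a.div S := by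
  classical
  simp only [a.represents.isCopy_iff hD, a.div_eq]

theorem EnumStr.dist_eq (i j : Fin n) : dist (a.tup i) (a.tup j) = a.div {i, j} := by
  classical
  rw [a.div_eq, a.represents.dist_eq', Finset.image_insert, Finset.image_singleton]

theorem EnumStr.interp_eq (R : divLang.Pred) (s : Fin (divLang.arity R) → Fin n) :
    a.str.interp R (fun k => a.tup (s k)) = a.div (Finset.univ.image s) := by
  classical
  rw [a.div_eq, a.represents.interp_eq', Finset.image_image]
  rfl

theorem exists_of_mem_predDiffs {r : ℝ} (h : r ∈ predDiffs a b) :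
    ∃ S, r = |a.div S - b.div S| := by
  rcases h with ⟨i, j, rfl⟩ | ⟨X, R, hX, rfl⟩
  · exact ⟨{i, j}, by rw [a.dist_eq, b.dist_eq]⟩
  · exact ⟨Finset.univ.image (X.orderEmbOfFin hX), by rw [a.interp_eq, b.interp_eq]⟩

theorem dInfty_nonneg : 0 ≤ dInfty a b := by
  refine Real.sSup_nonneg fun r hr => ?_
  obtain ⟨S, rfl⟩ := exists_of_mem_predDiffs a b hr
  exact abs_nonneg _

theorem abs_div_sub_le_dInfty (S : Finset (Fin n)) : |a.div S - b.div S| ≤ dInfty a b := by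
  rcases S.eq_empty_or_nonempty with rfl | hS
  · rw [a.isSemidiversity_div.empty, b.isSemidiversity_div.empty, sub_self, abs_zero]
    exact dInfty_nonneg a b
  let R : divLang.Pred := ⟨S.card, hS.card_pos⟩
  have hR : S.card = divLang.arity R := rfl
  have h1 : Finset.univ.image (S.orderEmbOfFin hR) = S := by
    rw [← Finset.coe_inj, Finset.coe_image, Finset.coe_univ, Set.image_univ,
      Finset.range_orderEmbOfFin]
  have ha := a.interp_eq R (S.orderEmbOfFin hR)
  have hb := b.interp_eq R (S.orderEmbOfFin hR)
  rw [h1] at ha hb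
  rw [← ha, ← hb]
  exact le_csSup (predDiffs_finite a b).bddAbove (Or.inr ⟨S, R, hR, rfl⟩)

theorem abs_div_sub_le_dist {a b : EnumStr finDiversities.{u} n} {D : MetricStr.{u} divLang}
    (hD : D ∈ finDiversities.{u}) {a' b' : Fin n → D} (ha : MetricStr.IsCopy a.tup a')
    (hb : MetricStr.IsCopy b.tup b') (S : Finset (Fin n)) :
    |a.div S - b.div S| ≤ n * dist a' b' := by
  classical
  have hDr := hD.2.represents
  rw [← (a.isCopy_iff hDr).1 ha, ← (b.isCopy_iff hDr).1 hb]
  refine (hDr.div.abs_image_sub_le S a' b').trans ?_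
  have h1 : ∑ i ∈ S, divOf D {a' i, b' i} ≤ S.card • dist a' b' :=
    Finset.sum_le_card_nsmul _ _ _ fun i _ => by
      rw [← hDr.dist_eq']
      exact dist_le_pi_dist a' b' i
  rw [nsmul_eq_mul] at h1
  refine h1.trans (mul_le_mul_of_nonneg_right ?_ dist_nonneg)
  have := S.card_le_univ
  rw [Fintype.card_fin] at this
  exact_mod_cast this

theorem exists_copies_dist_le_dInfty :
    ∃ D ∈ finDiversities.{u}, ∃ a' b' : Fin n → D,
      MetricStr.IsCopy a.tup a' ∧ MetricStr.IsCopy b.tup b' ∧ dist a' b' ≤ dInfty a b := by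
  classical
  obtain ⟨γ, hγ, h1, h2, h3⟩ := a.isSemidiversity_div.exists_coupling b.isSemidiversity_div
    (abs_div_sub_le_dInfty a b)
  obtain ⟨D, hD, π, δ, hDr, hπ⟩ := hγ.exists_realization
  have hπ' := hπ inferInstance
  refine ⟨D, hD, fun i => π (Sum.inl i), fun i => π (Sum.inr i),
    (a.isCopy_iff hDr).2 fun S => ?_, (b.isCopy_iff hDr).2 fun S => ?_,
    (dist_pi_le_iff (dInfty_nonneg a b)).2 fun i => ?_⟩
  · rw [← h1, ← hπ', Finset.image_image]
    rfl
  · rw [← h2, ← hπ', Finset.image_image]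
    rfl
  · have := hπ' {Sum.inl i, Sum.inr i}
    rw [Finset.image_insert, Finset.image_singleton, ← hDr.dist_eq'] at this
    rw [this]
    exact h3 i

theorem dK_le_dInfty : dK a b ≤ dInfty a b := by
  obtain ⟨D, hD, a', b', ha, hb, h⟩ := exists_copies_dist_le_dInfty a b
  exact (csInf_le (dK_bddBelow a b) ⟨D, hD, a', b', ha, hb, rfl⟩).trans h

theorem abs_div_sub_le_dK (S : Finset (Fin n)) : |a.div S - b.div S| ≤ n * dK a b := by
  obtain ⟨D, hD, a', b', ha, hb, _⟩ := exists_copies_dist_le_dInfty a b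
  rcases n.eq_zero_or_pos with rfl | hn
  · simpa using abs_div_sub_le_dist hD ha hb S
  have hn' : (0 : ℝ) < n := by exact_mod_cast hn
  rw [← div_le_iff₀' hn']
  refine le_csInf ⟨_, D, hD, a', b', ha, hb, rfl⟩ ?_
  rintro _ ⟨D, hD, a', b', ha, hb, rfl⟩
  rw [div_le_iff₀' hn']
  exact abs_div_sub_le_dist hD ha hb S

theorem dInfty_le_mul_dK (hn : 1 ≤ n) : dInfty a b ≤ n * dK a b := by
  refine csSup_le ⟨_, Or.inl ⟨⟨0, hn⟩, ⟨0, hn⟩, rfl⟩⟩ fun r hr => ?_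
  obtain ⟨S, rfl⟩ := exists_of_mem_predDiffs a b hr
  exact abs_div_sub_le_dK a b S

theorem cp_finDiversities : CP finDiversities.{u} := by
  have key : ∀ (n : ℕ) (ε : ℝ), 0 < ε → ∃ η > 0, ∀ (a b : EnumStr finDiversities.{u} n)
      (S : Finset (Fin n)), dK a b < η → |b.div S - a.div S| < ε := by
    intro n ε hε
    refine ⟨ε / (n + 1), by positivity, fun a b S h => ?_⟩
    have h1 := abs_div_sub_le_dK a b S
    rw [lt_div_iff₀ (by positivity)] at h
    rw [abs_sub_comm]
    have h2 : 0 ≤ dK a b := by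
      refine Real.sInf_nonneg ?_
      rintro _ ⟨D, _, a', b', _, _, rfl⟩
      exact dist_nonneg
    linarith [mul_comm (n : ℝ) (dK a b)]
  refine ⟨fun R a ε hε => ?_, fun a ε hε => ?_⟩
  · obtain ⟨η, hη, h⟩ := key _ ε hε
    refine ⟨η, hη, fun b hb => ?_⟩
    have := h a b (Finset.univ.image id) hb
    rwa [← a.interp_eq R id, ← b.interp_eq R id] at this
  · obtain ⟨η, hη, h⟩ := key _ ε hε
    refine ⟨η, hη, fun b hb => ?_⟩
    rw [a.dist_eq, b.dist_eq]
    exact h a b _ hb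

/-- In the minimal amalgam over the common entries, the two last entries are at distance sup |f₁ -
f₂|, and each of these differences is bounded by d_∞. -/
theorem bapWith_finDiversities (n : ℕ) : BAPWith finDiversities.{u} n 1 := by
  classical
  intro p q hpq
  -- The index set is viewed as the n common indices plus a point `none`, which stands for the last
  -- entry.
  let e : Option (Fin n) → Fin (n + 1) := fun o => o.elim (Fin.last n) Fin.castSucc
  let o : Fin (n + 1) → Option (Fin n) := Fin.lastCases none some
  have hol : o (Fin.last n) = none := by simp [o]
  have hoc : ∀ i : Fin n, o i.castSucc = some i := fun i => by simp [o]
  have heo : ∀ j, e (o j) = j := by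
    intro j
    induction j using Fin.lastCases with
    | last => rw [hol]; rfl
    | cast i => rw [hoc]; rfl
  have himg : ∀ S : Finset (Fin (n + 1)), (S.image o).image e = S := fun S => by
    rw [Finset.image_image, show e ∘ o = id from funext heo, Finset.image_id]
  have hp := p.isSemidiversity_div.comap e
  have hq := q.isSemidiversity_div.comap e
  have hagree : ∀ A : Finset (Fin n), p.div ((A.map Function.Embedding.some).image e) =
      q.div ((A.map Function.Embedding.some).image e) := by
    intro A
    have h1 := (p.represents.isCopy_iff q.represents).1 hpq A
    have h2 : (A.map Function.Embedding.some).image e = A.image Fin.castSucc := by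
      ext j
      simp [e]
    rw [h2, p.div_eq, q.div_eq, Finset.image_image, Finset.image_image]
    exact h1.symm
  have hγ := isOnePointAmalgam_minAmalgam hp hq hagree
  have hdist := minAmalgam_univ_inr (fun S => p.div (S.image e)) (fun S => q.div (S.image e))
  set γ := minAmalgam (fun S => p.div (S.image e)) (fun S => q.div (S.image e))
  obtain ⟨D, hD, π, δ, hDr, hπ⟩ := hγ.semi.exists_realization
  have hπ' := hπ inferInstance
  have hleft : ∀ A : Finset (Option (Fin n)), γ (A.image (inclPt false)) = p.div (A.image e) :=
    fun A => by rw [← hγ.left]; congr!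
  have hright : ∀ A : Finset (Option (Fin n)), γ (A.image (inclPt true)) = q.div (A.image e) :=
    fun A => by rw [← hγ.right]; congr!
  refine ⟨D, hD, fun j => π (inclPt false (o j)), fun j => π (inclPt true (o j)),
    (p.isCopy_iff hDr).2 fun S => ?_, (q.isCopy_iff hDr).2 fun S => ?_, fun i => ?_, ?_⟩
  · have h1 := hπ' ((S.image o).image (inclPt false))
    rw [hleft, himg, Finset.image_image, Finset.image_image] at h1
    exact h1
  · have h1 := hπ' ((S.image o).image (inclPt true))
    rw [hright, himg, Finset.image_image, Finset.image_image] at h1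
    exact h1
  · simp only [hoc]
    rfl
  · have h1 := hπ' (Finset.univ.map Function.Embedding.inr)
    have h2 : (Finset.univ.map Function.Embedding.inr : Finset (Fin n ⊕ Bool)).image π =
        {π (Sum.inr false), π (Sum.inr true)} := by
      ext x
      simp [or_comm]
    rw [h2, hdist, ← hDr.dist_eq'] at h1
    rw [one_mul]
    simp only [hol]
    refine h1.le.trans (ciSup_le fun A => ?_)
    exact abs_div_sub_le_dInfty p q _

end Distances

/-! ### The hereditary property and the main theorem -/

theorem hp_finDiversities : HP finDiversities.{u} := fun _ hA => hA.2.isKStructure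

theorem mainTheorem3 :
    -- the class of finite diversities satisfies HP, JEP, bAP, PP, CP
    HP finDiversities.{u} ∧ JEP finDiversities.{u} ∧ BAP finDiversities.{u} ∧
    PP finDiversities.{u} ∧ CP finDiversities.{u} ∧
    -- it is a Fraïssé class
    IsFraisseClass finDiversities.{u} ∧
    -- its limit exists, is an exact limit and is ultrahomogeneous; it is a diversity, universal
    -- for separable diversities, and unique up to isomorphism (the Urysohn diversity)
    (∃ M : MetricStr.{u} divLang,
      IsApproxLimit finDiversities.{u} M ∧ IsExactLimit finDiversities.{u} M ∧
      M.Ultrahomogeneous ∧ IsDiversityStr M ∧ IsUniversalFor finDiversities.{u} M ∧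
      (∀ N : MetricStr.{u} divLang, IsApproxLimit finDiversities.{u} N →
        Nonempty (MetricStr.Iso M N)) ∧
      (∀ N : MetricStr.{u} divLang, IsKStructure finDiversities.{u} N →
        N.Ultrahomogeneous → IsUniversalFor finDiversities.{u} N →
        Nonempty (MetricStr.Iso M N))) ∧
    -- bAP holds with constant 1
    (∀ n : ℕ, BAPWith finDiversities.{u} n 1) ∧
    -- the explicit one-point amalgamation: it extends both diversities, is minimal, is a
    -- diversity unless it identifies the two points, and their distance is the displayed one
    (∀ (X : Type u) [Finite X] (δ₁ δ₂ : Finset (Option X) → ℝ),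
      IsDiversity δ₁ → IsDiversity δ₂ →
      (∀ A : Finset X,
        δ₁ (A.map Function.Embedding.some) = δ₂ (A.map Function.Embedding.some)) →
      IsOnePointAmalgam δ₁ δ₂ (minAmalgam δ₁ δ₂) ∧
      (∀ γ : Finset (X ⊕ Bool) → ℝ, IsOnePointAmalgam δ₁ δ₂ γ →
        ∀ S, minAmalgam δ₁ δ₂ S ≤ γ S) ∧
      (minAmalgam δ₁ δ₂ (Finset.univ.map Function.Embedding.inr) ≠ 0 →
        IsDiversity (minAmalgam δ₁ δ₂)) ∧
      minAmalgam δ₁ δ₂ (Finset.univ.map Function.Embedding.inr) =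
        ⨆ A : Finset X, |δ₁ (Finset.insertNone A) - δ₂ (Finset.insertNone A)|) ∧
    -- Lipschitz equivalence of the two distances of enumerated structures
    (∀ n : ℕ, 1 ≤ n → ∀ a b : EnumStr finDiversities.{u} n,
      (1 / (n : ℝ)) * dInfty a b ≤ dK a b ∧ dK a b ≤ dInfty a b) := by
  classical
  have hfin : ∀ A ∈ finDiversities.{u}, Finite A := fun A hA => hA.1
  obtain ⟨M, δ, hsep, hM, hext⟩ := exists_urysohn_diversity.{u}
  have hlim := hM.isExactLimit hsep hext
  have hunique : ∀ N : MetricStr.{u} divLang, IsApproxLimit finDiversities.{u} N →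
      Nonempty (MetricStr.Iso M N) := by
    intro N hN
    have hNr := hN.isKStructure.isDiversityStr.represents
    obtain ⟨f, _⟩ := hM.exists_iso_of_exactExt hNr hsep hN.separable hext
      (hN.exactExt hNr) (partialIso_empty hM.div.empty hNr.div.empty)
    exact ⟨f⟩
  refine ⟨hp_finDiversities, hlim.jep hfin, fun n => ⟨1, bapWith_finDiversities n⟩, hlim.pp,
    cp_finDiversities,
    ⟨hfin, hp_finDiversities, hlim.jep hfin, hlim.ap hfin, hlim.pp, cp_finDiversities⟩,
    ⟨M, hlim.isApproxLimit, hlim, hM.ultrahomogeneous hsep hext, hM.isDiversityStr,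
      hM.isUniversalFor hext, hunique, fun N hK hN hu =>
        hunique N (hu.isExactLimit hfin hp_finDiversities hK hN).isApproxLimit⟩,
    bapWith_finDiversities, ?_, ?_⟩
  · intro X _ δ₁ δ₂ h₁ h₂ h
    have hγ := isOnePointAmalgam_minAmalgam h₁.toIsSemidiversity h₂.toIsSemidiversity h
    exact ⟨hγ, fun γ h' => minAmalgam_le h', hγ.isDiversity h₁ h₂, minAmalgam_univ_inr δ₁ δ₂⟩
  · intro n hn a b
    refine ⟨?_, dK_le_dInfty a b⟩
    have hn' : (0 : ℝ) < n := by exact_mod_cast hn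
    rw [one_div, inv_mul_le_iff₀ hn']
    exact dInfty_le_mul_dK a b hn
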